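/- Let $\mathring H^{1/2}(\mathbb R^2)$ be the completion of $C_c^\infty(\mathbb R^2)$ (real-valued) with respect to the Gagliardo norm $$\|u\|_{\mathring H^{1/2}}^2=\frac1{4\pi}\iint_{\mathbb R^2\times\mathbb R^2}\frac{|u(x)-u(y)|^2}{|x-y|^3}\,dx\,dy ,$$ realized as a space of functions in $L^4(\mathbb R^2)$ by means of the Sobolev inequality, and let $\mathring H^{-1/2}(\mathbb R^2)$ be its dual Hilbert space. A function $\rho\in L^1_{\mathrm{loc}}(\mathbb R^2)$ belongs to $\mathring H^{-1/2}(\mathbb R^2)$ if $\varphi\mapsto\int\rho\varphi$, $\varphi\in C_c^\infty(\mathbb R^2)$, is bounded by a multiple of $\|\varphi\|_{\mathring H^{1/2}}$; then $\langle\rho,\cdot\rangle$ denotes the continuous extension of this functional to $\mathring H^{1/2}(\mathbb R^2)$. Put $\mathcal H_0=\mathring H^{-1/2}(\mathbb R^2)\cap L^{3/2}(\mathbb R^2)$. For $\rho\in\mathcal H_0$ and $V=V_1+V_2$ with $V_1\in\mathring H^{1/2}(\mathbb R^2)$ and $V_2\in L^3(\mathbb R^2)$, put $$\langle\rho,V\rangle=\langle\rho,V_1\rangle+\int_{\mathbb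 R^2}\rho V_2\,dx,\qquad \mathcal E_0(\rho)=\frac23\int_{\mathbb R^2}|\rho|^{3/2}\,dx-\langle\rho,V\rangle+\frac12\|\rho\|_{\mathring H^{-1/2}}^2 .$$ **Theorem.** Let $V\in\mathring H^{1/2}(\mathbb R^2)+L^3(\mathbb R^2)$. Then $\langle\rho,V\rangle$ does not depend on the decomposition $V=V_1+V_2$, for any $\rho\in\mathcal H_0$, and there exists a unique (up to equality almost everywhere) $\rho_V\in\mathcal H_0$ with $\mathcal E_0(\rho_V)=\inf_{\rho\in\mathcal H_0}\mathcal E_0(\rho)$. This minimizer satisfies the Euler–Lagrange equation $$\int_{\mathbb R^2}\operatorname{sgn}(\rho_V)|\rho_V|^{1/2}\varphi\,dx-\langle\varphi,V\rangle+\langle\rho_V,\varphi\rangle_{\mathring H^{-1/2}}=0\qquad\text{for all }\varphi\in\mathcal H_0 .$$ Furthermore, if $(-\Delta)^{1/2}V\ge0$ in the sense of distributions, i.e. $\int_{\mathbb R^2}V\,(-\Delta)^{1/2}\varphi\,dx\ge0$ for all $0\le\varphi\in C_c^\infty(\mathbb R^2)$, where $$(-\Delta)^{1/2}\varphi(x)=\frac1{4\pi}\int_{\mathbb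 R^2}\frac{2\varphi(x)-\varphi(x+y)-\varphi(x-y)}{|y|^3}\,dy ,$$ then $\rho_V\ge0$ almost everywhere. -/

import Mathlib

open MeasureTheory Filter Topology
open scoped ENNReal

noncomputable section

namespace GrapheneTF

/-- The Euclidean plane `ℝ²`. -/
abbrev Plane : Type := EuclideanSpace ℝ (Fin 2)

/-- Real test functions: smooth and compactly supported functions on the plane. -/
abbrev Test : Type :=
  TestFunction (⊤ : TopologicalSpace.Opens Plane) ℝ (⊤ : ℕ∞)

/-- The squared Gagliardo norm
`(1 / 4π) ∬ |u(x) - u(y)|² / |x - y|³ dx dy`, as an element of `[0, ∞]`. -/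
def gagliardoSq (u : Plane → ℝ) : ℝ≥0∞ :=
  ENNReal.ofReal (1 / (4 * Real.pi)) *
    ∫⁻ z : Plane × Plane, ENNReal.ofReal ((u z.1 - u z.2) ^ 2 / ‖z.1 - z.2‖ ^ 3)

/-- The Gagliardo norm as a real number. -/
def hHalfNorm (u : Plane → ℝ) : ℝ := Real.sqrt (gagliardoSq u).toReal

/-- `u` belongs to the homogeneous Sobolev space `Ḣ^{1/2}(ℝ²)`, the completion of the test
functions in the Gagliardo norm. By the Sobolev inequality, the completion is a space of
functions inside `L⁴(ℝ²)`: its elements are the limits in `L⁴` of the sequences of test functions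
that are Cauchy in the Gagliardo norm. -/
def MemHHalf (u : Plane → ℝ) : Prop :=
  MemLp u 4 ∧ ∃ φ : ℕ → Test,
    Tendsto (fun n => gagliardoSq (fun x => u x - φ n x)) atTop (𝓝 0) ∧
    Tendsto (fun n => eLpNorm (fun x => u x - φ n x) 4 volume) atTop (𝓝 0)

/-- The regular distribution generated by `ρ` belongs to the dual space `Ḣ^{-1/2}(ℝ²)`. -/
def MemHNegHalf (ρ : Plane → ℝ) : Prop :=
  LocallyIntegrable ρ ∧ ∃ C : ℝ, ∀ φ : Test, |∫ x, ρ x * φ x| ≤ C * hHalfNorm φ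

/-- The norm of `ρ` in `Ḣ^{-1/2}(ℝ²)`: the dual norm. -/
def hNegHalfNorm (ρ : Plane → ℝ) : ℝ :=
  sSup {r : ℝ | ∃ φ : Test, hHalfNorm φ ≤ 1 ∧ r = |∫ x, ρ x * φ x|}

/-- The inner product of `Ḣ^{-1/2}(ℝ²)`, the one which induces the dual norm (polarization). -/
def hNegHalfInner (ρ σ : Plane → ℝ) : ℝ :=
  (hNegHalfNorm (fun x => ρ x + σ x) ^ 2 - hNegHalfNorm (fun x => ρ x - σ x) ^ 2) / 4

/-- The duality pairing of `ρ ∈ Ḣ^{-1/2}(ℝ²)` with `u ∈ Ḣ^{1/2}(ℝ²)`: the value at `u` of the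
continuous extension of `φ ↦ ∫ ρ φ` from test functions to `Ḣ^{1/2}(ℝ²)`, i.e. the limit of
`∫ ρ φ` as the test function `φ` tends to `u` in the Gagliardo norm. -/
def hPair (ρ u : Plane → ℝ) : ℝ :=
  limUnder (comap (fun φ : Test => gagliardoSq (fun x => u x - φ x)) (𝓝 0))
    (fun φ : Test => ∫ x, ρ x * φ x)

/-- The space `H₀ = Ḣ^{-1/2}(ℝ²) ∩ L^{3/2}(ℝ²)`. -/
def MemH0 (ρ : Plane → ℝ) : Prop := MemHNegHalf ρ ∧ MemLp ρ (3 / 2)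

/-- `V = V₁ + V₂` almost everywhere, with `V₁ ∈ Ḣ^{1/2}(ℝ²)` and `V₂ ∈ L³(ℝ²)`. -/
def IsDecomposition (V V₁ V₂ : Plane → ℝ) : Prop :=
  MemHHalf V₁ ∧ MemLp V₂ 3 ∧ V =ᵐ[volume] fun x => V₁ x + V₂ x

/-- `V` belongs to `Ḣ^{1/2}(ℝ²) + L³(ℝ²)`. -/
def MemDual (V : Plane → ℝ) : Prop := ∃ V₁ V₂ : Plane → ℝ, IsDecomposition V V₁ V₂

open Classical in
/-- The duality pairing `⟨ρ, V⟩ = ⟨ρ, V₁⟩ + ∫ ρ V₂` of `ρ ∈ H₀` with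
`V = V₁ + V₂ ∈ Ḣ^{1/2}(ℝ²) + L³(ℝ²)`, computed with some decomposition of `V`. -/
def dualPairing (ρ V : Plane → ℝ) : ℝ :=
  if h : MemDual V then hPair ρ h.choose + ∫ x, ρ x * h.choose_spec.choose x else 0

/-- The Thomas–Fermi energy
`(2/3) ∫ |ρ|^{3/2} - ⟨ρ, V⟩ + (1/2) ‖ρ‖²` with the norm of `Ḣ^{-1/2}(ℝ²)`. -/
def energy (V ρ : Plane → ℝ) : ℝ :=
  2 / 3 * (∫ x, |ρ x| ^ (3 / 2 : ℝ)) - dualPairing ρ V + 1 / 2 * hNegHalfNorm ρ ^ 2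

/-- `ρ` minimizes the Thomas–Fermi energy over `H₀`. -/
def IsMinimizer (V ρ : Plane → ℝ) : Prop :=
  MemH0 ρ ∧ ∀ σ : Plane → ℝ, MemH0 σ → energy V ρ ≤ energy V σ

/-- The weak Euler–Lagrange equation of the Thomas–Fermi energy. -/
def EulerLagrange (V ρ : Plane → ℝ) : Prop :=
  ∀ φ : Plane → ℝ, MemH0 φ →
    (∫ x, Real.sign (ρ x) * |ρ x| ^ (1 / 2 : ℝ) * φ x) - dualPairing φ V + hNegHalfInner ρ φ = 0

/-- The half-Laplacian `(-Δ)^{1/2} u` (for a test function `u`). -/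
def halfLaplacian (u : Plane → ℝ) (x : Plane) : ℝ :=
  1 / (4 * Real.pi) * ∫ y, (2 * u x - u (x + y) - u (x - y)) / ‖y‖ ^ 3

/-- `(-Δ)^{1/2} V ≥ 0` in the sense of distributions. -/
def HalfLaplacianNonneg (V : Plane → ℝ) : Prop :=
  ∀ φ : Test, (∀ x, 0 ≤ φ x) → 0 ≤ ∫ x, V x * halfLaplacian φ x

end GrapheneTF

end

/-! Sending `u` to the difference `u x - u y` embeds the homogeneous Sobolev space isometrically
into `L²` of the measure `dx dy / (4π |x - y|³)`. The closure `hSpace` of the differences of test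
functions is a Hilbert space, and each `ρ` in the dual space has a Riesz representative `f` there
(`HasRep`) with `hNegHalfNorm ρ = ‖f‖`. The energy is then a power integral, minus a linear term,
plus half a squared Hilbert norm. The `L⁴` convergence is part of `MemHHalf`, so the Sobolev
inequality itself never enters.

Independence of the decomposition amounts to `⟨ρ, W⟩ = ∫ ρ W` for `W` in both the Sobolev space and
`L³` (`HasRep.inner_eq_integral`). Test functions converging to `W` are truncated at the levels `±
|W|`: they still converge in the Gagliardo norm, and `|ρ W|` now dominates the integrands.

The energy is bounded below (`exists_coercive`) and uniformly convex (`energy_gap`): the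
parallelogram law handles the Hilbert norm, a pointwise inequality handles `|a| ^ (3 / 2)`. Hence
minimizing sequences are Cauchy in both norms and converge strongly, with no weak compactness
argument; the same inequality gives uniqueness. The Euler–Lagrange equation is the first variation.

For positivity, let `u` be the signed square root of the minimizer `ρ`. The Euler–Lagrange equation
tested with `(-Δ)^{1/2} φ` reads `(-Δ)^{1/2} u + ρ = (-Δ)^{1/2} V ≥ 0` in the sense of
distributions. Formally, testing with the negative part of `u` makes the first term nonpositive,
because `(U x - U y) (b x - b y) ≤ 0` when `b` is a nonincreasing function of `U`. So the integral
of `ρ` against that negative part is both nonnegative and nonpositive, and `ρ` is nowhere negative.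
To have smooth compactly supported tests, `u` is mollified, cut at `-δ` instead of `0`, and
mollified again. -/

noncomputable section

namespace GrapheneTF

open scoped Convolution
open ContinuousLinearMap (lsmul)

/-! ### Mollification on the plane -/

/-- A sequence of smooth bump functions shrinking to the origin. -/
def bump (n : ℕ) : ContDiffBump (0 : Plane) where
  rIn := 1 / (n + 2)
  rOut := 1 / (n + 1)
  rIn_pos := by positivity
  rIn_lt_rOut := by gcongr; norm_num

/-- The mollifier kernels. -/
def kern (n : ℕ) : Plane → ℝ := (bump n).normed volume

/-- Mollification of a function. -/
def moll (n : ℕ) (f : Plane → ℝ) : Plane → ℝ := kern n ⋆[lsmul ℝ ℝ, volume] f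

theorem moll_apply (n : ℕ) (f : Plane → ℝ) (x : Plane) :
    moll n f x = ∫ t, kern n t * f (x - t) := rfl

theorem kern_nonneg (n : ℕ) (x : Plane) : 0 ≤ kern n x := (bump n).nonneg_normed x

theorem kern_neg (n : ℕ) (x : Plane) : kern n (-x) = kern n x := (bump n).normed_neg x

theorem continuous_kern (n : ℕ) : Continuous (kern n) := (bump n).continuous_normed

theorem hasCompactSupport_kern (n : ℕ) : HasCompactSupport (kern n) :=
  (bump n).hasCompactSupport_normed

theorem contDiff_kern (n : ℕ) : ContDiff ℝ (⊤ : ℕ∞) (kern n) := (bump n).contDiff_normed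

theorem integrable_kern (n : ℕ) : Integrable (kern n) := (bump n).integrable_normed

theorem integral_kern (n : ℕ) : ∫ x, kern n x = 1 := (bump n).integral_normed

theorem support_kern_subset (n : ℕ) : Function.support (kern n) ⊆ Metric.ball 0 (1 / (n + 1)) :=
  (bump n).support_normed_eq.subset

theorem tendsto_bump_rOut : Tendsto (fun n => (bump n).rOut) atTop (𝓝 0) :=
  tendsto_one_div_add_atTop_nhds_zero_nat

attribute [irreducible] bump

theorem contDiff_moll (n : ℕ) {f : Plane → ℝ} (hf : LocallyIntegrable f) :
    ContDiff ℝ (⊤ : ℕ∞) (moll n f) :=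
  (hasCompactSupport_kern n).contDiff_convolution_left _ (contDiff_kern n) hf

theorem hasCompactSupport_moll (n : ℕ) {f : Plane → ℝ} (hf : HasCompactSupport f) :
    HasCompactSupport (moll n f) :=
  (hasCompactSupport_kern n).convolution _ hf

/-- The mollification of a compactly supported integrable function, as a test function. -/
def mollTest (n : ℕ) (f : Plane → ℝ) (hf : LocallyIntegrable f) (hc : HasCompactSupport f) : Test :=
  ⟨moll n f, contDiff_moll n hf, hasCompactSupport_moll n hc, fun _ _ => trivial⟩

theorem convolutionExists_kern (n : ℕ) {f : Plane → ℝ} (hf : LocallyIntegrable f) :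
    ConvolutionExists (kern n) f (lsmul ℝ ℝ) volume :=
  (hasCompactSupport_kern n).convolutionExists_left _ (continuous_kern n) hf

theorem moll_add (n : ℕ) {f g : Plane → ℝ} (hf : LocallyIntegrable f) (hg : LocallyIntegrable g) :
    moll n (f + g) = moll n f + moll n g :=
  (convolutionExists_kern n hf).distrib_add (convolutionExists_kern n hg)

theorem moll_neg (n : ℕ) (f : Plane → ℝ) : moll n (-f) = - moll n f := by
  ext x
  simp [moll_apply, integral_neg]

theorem moll_sub (n : ℕ) {f g : Plane → ℝ} (hf : LocallyIntegrable f) (hg : LocallyIntegrable g) :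
    moll n (f - g) = moll n f - moll n g := by
  rw [sub_eq_add_neg, moll_add n hf hg.neg, moll_neg, sub_eq_add_neg]

/-- Jensen's inequality for powers on a probability space. -/
theorem lintegral_enorm_rpow_le {α : Type*} [MeasurableSpace α] (ν : Measure α)
    [IsProbabilityMeasure ν] {f : α → ℝ} (hf : AEStronglyMeasurable f ν) {q : ℝ} (hq : 1 ≤ q) :
    (∫⁻ x, ‖f x‖ₑ ∂ν) ^ q ≤ ∫⁻ x, ‖f x‖ₑ ^ q ∂ν := by
  have h := eLpNorm'_le_eLpNorm'_of_exponent_le zero_lt_one hq ν hf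
  simp only [eLpNorm', ENNReal.rpow_one, div_one] at h
  calc (∫⁻ x, ‖f x‖ₑ ∂ν) ^ q ≤ ((∫⁻ x, ‖f x‖ₑ ^ q ∂ν) ^ (1 / q)) ^ q := by gcongr
    _ = _ := by rw [← ENNReal.rpow_mul, one_div_mul_cancel (by positivity), ENNReal.rpow_one]

/-- The probability measure with density `kern n`. -/
def kernMeas (n : ℕ) : Measure Plane := volume.withDensity fun x => ENNReal.ofReal (kern n x)

instance (n : ℕ) : IsProbabilityMeasure (kernMeas n) := by
  constructor
  rw [kernMeas, withDensity_apply _ MeasurableSet.univ, Measure.restrict_univ,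
    ← ofReal_integral_eq_lintegral_ofReal (integrable_kern n)
      (Eventually.of_forall (kern_nonneg n)), integral_kern, ENNReal.ofReal_one]

theorem kernMeas_absolutelyContinuous (n : ℕ) : kernMeas n ≪ volume :=
  withDensity_absolutelyContinuous _ _

theorem enorm_moll_le (n : ℕ) (f : Plane → ℝ) (x : Plane) :
    ‖moll n f x‖ₑ ≤ ∫⁻ t, ‖f (x - t)‖ₑ ∂kernMeas n := by
  rw [moll_apply, kernMeas, lintegral_withDensity_eq_lintegral_mul_non_measurable _
    (by have := (continuous_kern n).measurable; fun_prop) (by simp)]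
  refine (enorm_integral_le_lintegral_enorm _).trans (lintegral_mono fun t => ?_)
  rw [enorm_mul, Real.enorm_eq_ofReal (kern_nonneg n t)]
  rfl

/-- A mollification is an average of translates against the probability measure `kernMeas n`, so
Jensen's inequality, Tonelli's theorem and translation invariance give the bound. -/
theorem eLpNorm_moll_le (n : ℕ) {f : Plane → ℝ} (hf : AEStronglyMeasurable f) {p : ℝ≥0∞}
    (hp : 1 ≤ p) (hp' : p ≠ ∞) : eLpNorm (moll n f) p ≤ eLpNorm f p := by
  have hq : 1 ≤ p.toReal := by
    rw [← ENNReal.toReal_one]; exact ENNReal.toReal_mono hp' hp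
  have hp0 : p ≠ 0 := (zero_lt_one.trans_le hp).ne'
  rw [eLpNorm_eq_lintegral_rpow_enorm_toReal hp0 hp',
    eLpNorm_eq_lintegral_rpow_enorm_toReal hp0 hp']
  refine ENNReal.rpow_le_rpow ?_ (by positivity)
  have hsub : ∀ x : Plane, AEStronglyMeasurable (fun t => f (x - t)) volume := fun x =>
    hf.comp_quasiMeasurePreserving (quasiMeasurePreserving_sub_left volume x)
  have hmeas : AEMeasurable (Function.uncurry fun x t : Plane => ‖f (x - t)‖ₑ ^ p.toReal)
      (volume.prod (kernMeas n)) := by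
    have h1 : AEStronglyMeasurable (fun z : Plane × Plane => f (z.1 - z.2))
        (volume.prod (kernMeas n)) := by
      refine AEStronglyMeasurable.mono_ac
        (Measure.AbsolutelyContinuous.prod .rfl (kernMeas_absolutelyContinuous n)) ?_
      exact hf.comp_quasiMeasurePreserving
        (quasiMeasurePreserving_sub_of_right_invariant volume volume)
    exact h1.enorm.pow_const _
  calc ∫⁻ x, ‖moll n f x‖ₑ ^ p.toReal
      ≤ ∫⁻ x, ∫⁻ t, ‖f (x - t)‖ₑ ^ p.toReal ∂kernMeas n := by
        refine lintegral_mono fun x => ?_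
        exact (ENNReal.rpow_le_rpow (enorm_moll_le n f x) (by positivity)).trans
          (lintegral_enorm_rpow_le _ ((hsub x).mono_ac (kernMeas_absolutelyContinuous n)) hq)
    _ = ∫⁻ t, ∫⁻ x, ‖f (x - t)‖ₑ ^ p.toReal ∂volume ∂kernMeas n := lintegral_lintegral_swap hmeas
    _ = ∫⁻ t, ∫⁻ x, ‖f x‖ₑ ^ p.toReal ∂volume ∂kernMeas n := by
        refine lintegral_congr fun t => ?_
        exact lintegral_sub_right_eq_self (fun x => ‖f x‖ₑ ^ p.toReal) t
    _ = ∫⁻ x, ‖f x‖ₑ ^ p.toReal := by simp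

theorem continuous_moll (n : ℕ) {f : Plane → ℝ} (hf : LocallyIntegrable f) :
    Continuous (moll n f) := (contDiff_moll n hf).continuous

theorem memLp_moll (n : ℕ) {f : Plane → ℝ} {p : ℝ≥0∞} (hf : MemLp f p) (hp : 1 ≤ p)
    (hp' : p ≠ ∞) : MemLp (moll n f) p :=
  ⟨(continuous_moll n (hf.locallyIntegrable hp)).aestronglyMeasurable,
    (eLpNorm_moll_le n hf.1 hp hp').trans_lt hf.2⟩

/-- Uniform continuity gives uniform convergence, and all the differences vanish outside one compact
neighbourhood `S` of the support. -/
theorem tendsto_eLpNorm_moll_sub_of_continuous {g : Plane → ℝ} (hg : Continuous g)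
    (hc : HasCompactSupport g) {p : ℝ≥0∞} (hp : 1 ≤ p) (hp' : p ≠ ∞) :
    Tendsto (fun n => eLpNorm (moll n g - g) p) atTop (𝓝 0) := by
  set S : Set Plane := Metric.cthickening 1 (tsupport g)
  have hS : IsCompact S := hc.isCompact.cthickening
  have hV : volume S ≠ ∞ := hS.measure_lt_top.ne
  have hp0 : p ≠ 0 := (zero_lt_one.trans_le hp).ne'
  have hq : 0 < p.toReal := ENNReal.toReal_pos hp0 hp'
  have hsupp : ∀ n, ∀ x ∉ S, moll n g x - g x = 0 := by
    intro n x hx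
    have h1 : x ∉ tsupport g := fun h => hx (Metric.self_subset_cthickening _ h)
    rw [image_eq_zero_of_notMem_tsupport h1, sub_zero, moll_apply]
    refine integral_eq_zero_of_ae (Eventually.of_forall fun t => ?_)
    by_cases ht : kern n t = 0
    · simp [ht]
    have ht' := support_kern_subset n ht
    have hlt : ‖t‖ ≤ 1 := by
      have : ‖t‖ < 1 / ((n : ℝ) + 1) := by simpa using ht'
      refine this.le.trans ?_
      rw [div_le_one (by positivity)]; linarith [(Nat.cast_nonneg n : (0 : ℝ) ≤ n)]
    have : x - t ∉ tsupport g := fun h => hx <| by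
      refine Metric.mem_cthickening_of_dist_le x (x - t) 1 _ h ?_
      simpa [dist_eq_norm] using hlt
    simp [image_eq_zero_of_notMem_tsupport this]
  have hbound : ∀ ε : ℝ, 0 < ε → ∀ᶠ n in atTop,
      eLpNorm (moll n g - g) p ≤ ENNReal.ofReal ε * volume S ^ (1 / p.toReal) := by
    intro ε hε
    obtain ⟨δ, hδ, hgδ⟩ := Metric.uniformContinuous_iff.1
      (hc.uniformContinuous_of_continuous hg) ε hε
    filter_upwards [tendsto_bump_rOut.eventually (gt_mem_nhds hδ)] with n hn
    have hpt : ∀ x, ‖moll n g x - g x‖ ≤ ε := fun x => by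
      rw [← dist_eq_norm]
      refine ContDiffBump.dist_normed_convolution_le hg.aestronglyMeasurable fun y hy => ?_
      exact (hgδ ((Metric.mem_ball.1 hy).trans hn)).le
    have heq : (moll n g - g) = S.indicator (moll n g - g) := by
      ext x
      by_cases hx : x ∈ S
      · simp [hx]
      · rw [Set.indicator_of_notMem hx]; exact hsupp n x hx
    rw [heq, eLpNorm_indicator_eq_eLpNorm_restrict hS.isClosed.measurableSet]
    refine (eLpNorm_le_of_ae_bound (C := ε) (Eventually.of_forall hpt)).trans (le_of_eq ?_)
    rw [Measure.restrict_apply_univ, mul_comm, one_div]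
  rw [ENNReal.tendsto_atTop_zero]
  intro η hη
  have hVp : volume S ^ (1 / p.toReal) ≠ ∞ := ENNReal.rpow_ne_top_of_nonneg (by positivity) hV
  have hlim : Tendsto (fun ε : ℝ => ENNReal.ofReal ε * volume S ^ (1 / p.toReal)) (𝓝[>] 0)
      (𝓝 (ENNReal.ofReal 0 * volume S ^ (1 / p.toReal))) :=
    ENNReal.Tendsto.mul_const
      ((ENNReal.continuous_ofReal.tendsto 0).mono_left nhdsWithin_le_nhds) (Or.inr hVp)
  rw [ENNReal.ofReal_zero, zero_mul] at hlim
  obtain ⟨ε, hε, hε'⟩ := ((hlim.eventually (gt_mem_nhds hη)).and self_mem_nhdsWithin).exists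
  obtain ⟨N, hN⟩ := eventually_atTop.1 (hbound ε hε')
  exact ⟨N, fun n hn => (hN n hn).trans hε.le⟩

/-- Density of continuous compactly supported functions, combined with the contraction property of
mollification. -/
theorem tendsto_eLpNorm_moll_sub {f : Plane → ℝ} {p : ℝ≥0∞} (hf : MemLp f p) (hp : 1 ≤ p)
    (hp' : p ≠ ∞) : Tendsto (fun n => eLpNorm (moll n f - f) p) atTop (𝓝 0) := by
  rw [ENNReal.tendsto_atTop_zero]
  intro η hη
  obtain ⟨ε, hε, hεη⟩ : ∃ ε : ℝ≥0∞, 0 < ε ∧ ε + (ε + ε) ≤ η := by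
    refine ⟨η / 3, ENNReal.div_pos hη.ne' (by simp), ?_⟩
    rw [← add_assoc, ENNReal.add_thirds]
  obtain ⟨g, hgc, hgf, hg, hgp⟩ := hf.exists_hasCompactSupport_eLpNorm_sub_le hp' hε.ne'
  obtain ⟨N, hN⟩ := (ENNReal.tendsto_atTop_zero.1
    (tendsto_eLpNorm_moll_sub_of_continuous hg hgc hp hp')) ε hε
  refine ⟨N, fun n hn => le_trans ?_ hεη⟩
  have hfl := hf.locallyIntegrable hp
  have hgl := hgp.locallyIntegrable hp
  have hdec : moll n f - f = moll n (f - g) + ((moll n g - g) - (f - g)) := by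
    rw [moll_sub n hfl hgl]; abel
  have h1 : AEStronglyMeasurable (f - g) volume := hf.1.sub hgp.1
  have h2 : AEStronglyMeasurable (moll n g - g) volume := (memLp_moll n hgp hp hp').1.sub hgp.1
  have h3 := eLpNorm_add_le (memLp_moll n (hf.sub hgp) hp hp').1 (h2.sub h1) hp
  rw [← hdec] at h3
  refine h3.trans (add_le_add ((eLpNorm_moll_le n h1 hp hp').trans hgf) ?_)
  exact (eLpNorm_sub_le h2 h1 hp).trans (add_le_add (hN n hn) hgf)

/-! ### The Gagliardo measure -/

/-- The kernel `1 / (4π |h|³)`. -/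
def rieszKernel (h : Plane) : ℝ := 1 / (4 * Real.pi) / ‖h‖ ^ 3

theorem rieszKernel_nonneg (h : Plane) : 0 ≤ rieszKernel h := by
  unfold rieszKernel; positivity

@[fun_prop]
theorem measurable_rieszKernel : Measurable rieszKernel := by
  unfold rieszKernel; fun_prop

/-- The measure `dh / (4π |h|³)` of the increments. -/
def incMeas : Measure Plane := volume.withDensity fun h => ENNReal.ofReal (rieszKernel h)

/-- The measure `dx dy / (4π |x - y|³)`. -/
def gagMeas : Measure (Plane × Plane) :=
  volume.withDensity fun z => ENNReal.ofReal (rieszKernel (z.1 - z.2))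

instance : SigmaFinite incMeas := SigmaFinite.withDensity_ofReal _

instance : SigmaFinite gagMeas := SigmaFinite.withDensity_ofReal _

theorem gagMeas_absolutelyContinuous : gagMeas ≪ volume := withDensity_absolutelyContinuous _ _

/-- The difference function `(x, y) ↦ u x - u y`. -/
def diff (u : Plane → ℝ) (z : Plane × Plane) : ℝ := u z.1 - u z.2

theorem gagliardoSq_eq_lintegral (u : Plane → ℝ) :
    gagliardoSq u = ∫⁻ z, ‖diff u z‖ₑ ^ (2 : ℝ) ∂gagMeas := by
  rw [gagMeas, lintegral_withDensity_eq_lintegral_mul_non_measurable _ (by fun_prop) (by simp),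
    gagliardoSq, ← lintegral_const_mul' _ _ ENNReal.ofReal_ne_top]
  refine lintegral_congr fun z => ?_
  rw [← ENNReal.ofReal_mul (by positivity), Pi.mul_apply, ← ofReal_norm,
    ENNReal.ofReal_rpow_of_nonneg (norm_nonneg _) (by norm_num),
    ← ENNReal.ofReal_mul (rieszKernel_nonneg _), rieszKernel, diff]
  congr 1
  norm_cast
  rw [Real.norm_eq_abs, sq_abs]
  ring

theorem gagliardoSq_eq (u : Plane → ℝ) : gagliardoSq u = eLpNorm (diff u) 2 gagMeas ^ 2 := by
  rw [gagliardoSq_eq_lintegral, eLpNorm_eq_lintegral_rpow_enorm_toReal (by simp) (by simp),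
    ENNReal.toReal_ofNat, ← ENNReal.rpow_natCast, ← ENNReal.rpow_mul]
  norm_num

theorem hHalfNorm_eq (u : Plane → ℝ) : hHalfNorm u = (eLpNorm (diff u) 2 gagMeas).toReal := by
  rw [hHalfNorm, gagliardoSq_eq, ENNReal.toReal_pow, Real.sqrt_sq ENNReal.toReal_nonneg]

theorem aestronglyMeasurable_diff {u : Plane → ℝ} (hu : AEStronglyMeasurable u) :
    AEStronglyMeasurable (diff u) gagMeas := by
  refine AEStronglyMeasurable.mono_ac gagMeas_absolutelyContinuous ?_
  exact (hu.comp_quasiMeasurePreserving Measure.quasiMeasurePreserving_fst).sub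
    (hu.comp_quasiMeasurePreserving Measure.quasiMeasurePreserving_snd)

theorem ae_gagMeas_of_ae {p : Plane → Prop} (h : ∀ᵐ x, p x) :
    ∀ᵐ z ∂gagMeas, p z.1 ∧ p z.2 := by
  refine gagMeas_absolutelyContinuous.ae_le ?_
  exact (Measure.quasiMeasurePreserving_fst.ae h).and (Measure.quasiMeasurePreserving_snd.ae h)

/-- In the coordinates `(h, x) ↦ (x, x + h)` the Gagliardo measure is a product measure. -/
theorem measurePreserving_shear :
    MeasurePreserving (fun z : Plane × Plane => (z.2, z.2 + z.1)) (incMeas.prod volume)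
      gagMeas := by
  have hmp := measurePreserving_prod_add_swap (volume : Measure Plane) (volume : Measure Plane)
  refine ⟨hmp.measurable, ?_⟩
  ext s hs
  rw [Measure.map_apply hmp.measurable hs, incMeas, prod_withDensity_left (by fun_prop),
    withDensity_apply _ (hmp.measurable hs), gagMeas, withDensity_apply _ hs]
  refine Eq.trans ?_ (hmp.setLIntegral_comp_preimage hs (f := fun z : Plane × Plane =>
    ENNReal.ofReal (rieszKernel (z.1 - z.2))) (by fun_prop))
  refine lintegral_congr fun z => ?_
  simp [rieszKernel]

theorem lintegral_gagMeas {F : Plane × Plane → ℝ≥0∞} (hF : AEMeasurable F gagMeas) :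
    ∫⁻ z, F z ∂gagMeas = ∫⁻ h, ∫⁻ x, F (x, x + h) ∂volume ∂incMeas := by
  rw [← measurePreserving_shear.map_eq] at hF ⊢
  rw [lintegral_map' hF measurePreserving_shear.measurable.aemeasurable, lintegral_prod]
  exact hF.comp_measurable measurePreserving_shear.measurable

/-- This weight dominates squared first differences and second differences of test functions, up to
constants. In polar coordinates the integrand is constant on `(0, 1]` and a multiple of `r ^ (-2)`
beyond `1`. -/
theorem integrable_min_sq : Integrable (fun h : Plane => min 1 (‖h‖ ^ 2)) incMeas := by
  rw [incMeas, integrable_withDensity_iff_integrable_smul' (by fun_prop) (by simp)]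
  have key : Integrable (fun h : Plane =>
      (fun r : ℝ => 1 / (4 * Real.pi) / r ^ 3 * min 1 (r ^ 2)) ‖h‖)
      volume := by
    refine (integrable_fun_norm_addHaar volume
      (f := fun r : ℝ => 1 / (4 * Real.pi) / r ^ 3 * min 1 (r ^ 2))).2 ?_
    simp only [finrank_euclideanSpace, Fintype.card_fin, smul_eq_mul]
    rw [← Set.Ioc_union_Ioi_eq_Ioi zero_le_one, integrableOn_union]
    constructor
    · refine (integrableOn_const (C := 1 / (4 * Real.pi)) (by simp) enorm_ne_top).congr_fun ?_
        measurableSet_Ioc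
      intro r hr
      have h1 : min 1 (r ^ 2) = r ^ 2 := min_eq_right (by nlinarith [hr.1, hr.2])
      have := hr.1.ne'
      simp only [h1]
      field_simp
      norm_num
    · have h2 : IntegrableOn (fun r : ℝ => 1 / (4 * Real.pi) * r ^ (-2 : ℝ)) (Set.Ioi 1) :=
        (integrableOn_Ioi_rpow_of_lt (by norm_num) zero_lt_one).const_mul _
      refine h2.congr_fun ?_ measurableSet_Ioi
      intro r (hr : 1 < r)
      have hr0 : 0 < r := by linarith
      have h1 : min 1 (r ^ 2) = 1 := min_eq_left (by nlinarith)
      have h3 : r ^ (-2 : ℝ) = (r ^ 2)⁻¹ := by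
        rw [Real.rpow_neg hr0.le]; norm_cast
      simp only [h1, h3]
      field_simp
      norm_num
  refine key.congr (Eventually.of_forall fun h => ?_)
  simp only [ENNReal.toReal_ofReal (rieszKernel_nonneg _), smul_eq_mul]
  rfl

theorem lintegral_min_sq_lt_top :
    ∫⁻ h : Plane, ENNReal.ofReal (min 1 (‖h‖ ^ 2)) ∂incMeas < ∞ := by
  rw [← ofReal_integral_eq_lintegral_ofReal integrable_min_sq
    (Eventually.of_forall fun h => by positivity)]
  exact ENNReal.ofReal_lt_top

/-- A bounded function vanishing away from three translates of a set has small integral. -/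
theorem lintegral_le_of_translates {g : Plane → ℝ≥0∞} {A : ℝ≥0∞} {K : Set Plane}
    (hK : MeasurableSet K) (h : Plane) (hA : ∀ x, g x ≤ A)
    (h0 : ∀ x, x ∉ K → x + h ∉ K → x - h ∉ K → g x = 0) :
    ∫⁻ x, g x ≤ 3 * volume K * A := by
  have hm : Measurable (K.indicator fun _ : Plane => A) := measurable_const.indicator hK
  calc ∫⁻ x, g x ≤ ∫⁻ x, (K.indicator (fun _ => A) x + (K.indicator (fun _ => A) (x + h) +
          K.indicator (fun _ => A) (x - h))) := by
        refine lintegral_mono fun x => ?_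
        by_cases h1 : x ∈ K
        · simp only [Set.indicator_of_mem h1]; exact (hA x).trans le_self_add
        by_cases h2 : x + h ∈ K
        · simp only [Set.indicator_of_mem h2]
          exact (hA x).trans (le_self_add.trans le_add_self)
        by_cases h3 : x - h ∈ K
        · simp only [Set.indicator_of_mem h3]
          exact (hA x).trans (le_add_self.trans le_add_self)
        simp [h0 x h1 h2 h3]
    _ = 3 * volume K * A := by
        rw [lintegral_add_left hm, lintegral_add_left (by fun_prop),
          lintegral_add_right_eq_self (fun x => K.indicator (fun _ => A) x) h,
          lintegral_sub_right_eq_self (fun x => K.indicator (fun _ => A) x) h,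
          lintegral_indicator_const hK]
        ring

/-! ### Test functions have finite Gagliardo norm. -/

theorem Test.exists_bound (φ : Test) : ∃ M : ℝ, 0 ≤ M ∧ ∀ x, |φ x| ≤ M := by
  obtain ⟨M, hM⟩ := φ.continuous.bounded_above_of_compact_support φ.hasCompactSupport
  exact ⟨M, (norm_nonneg _).trans (hM 0), hM⟩

theorem Test.exists_lipschitz (φ : Test) : ∃ C : ℝ, 0 ≤ C ∧ ∀ x y, |φ x - φ y| ≤ C * ‖x - y‖ := by
  obtain ⟨C, hC⟩ := ContDiff.lipschitzWith_of_hasCompactSupport φ.hasCompactSupport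
    (φ.contDiff) (by simp)
  exact ⟨C, C.2, fun x y => by simpa [Real.dist_eq, dist_eq_norm] using hC.dist_le_mul x y⟩

theorem Test.integrable (φ : Test) : Integrable φ :=
  φ.continuous.integrable_of_hasCompactSupport φ.hasCompactSupport

theorem Test.memLp (φ : Test) (p : ℝ≥0∞) : MemLp φ p :=
  φ.continuous.memLp_of_hasCompactSupport φ.hasCompactSupport

theorem Test.memLp_diff (φ : Test) : MemLp (diff φ) 2 gagMeas := by
  refine ⟨aestronglyMeasurable_diff φ.continuous.aestronglyMeasurable, ?_⟩
  have hm := aestronglyMeasurable_diff φ.continuous.aestronglyMeasurable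
  rw [eLpNorm_lt_top_iff_lintegral_rpow_enorm_lt_top (by simp) (by simp), ENNReal.toReal_ofNat,
    lintegral_gagMeas (hm.enorm.pow_const _)]
  obtain ⟨M, hM0, hM⟩ := φ.exists_bound
  obtain ⟨C, hC0, hC⟩ := φ.exists_lipschitz
  -- With this constant an increment of `φ` by `h` is at most `B * min 1 ‖h‖`: the sup bound serves
  -- large `h`, the Lipschitz bound small `h`.
  set B : ℝ := max (2 * M) C
  have hB : 0 ≤ B := hC0.trans (le_max_right _ _)
  have hK : volume (tsupport φ) ≠ ∞ := φ.hasCompactSupport.isCompact.measure_lt_top.ne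
  have hpt : ∀ x h : Plane, ‖diff φ (x, x + h)‖ₑ ^ (2 : ℝ) ≤
      ENNReal.ofReal (B ^ 2) * ENNReal.ofReal (min 1 (‖h‖ ^ 2)) := by
    intro x h
    rw [← ofReal_norm, ENNReal.ofReal_rpow_of_nonneg (norm_nonneg _) (by norm_num),
      ← ENNReal.ofReal_mul (by positivity)]
    refine ENNReal.ofReal_le_ofReal ?_
    norm_cast
    rw [Real.norm_eq_abs, sq_abs, mul_min_of_nonneg _ _ (by positivity), ← mul_pow, mul_one]
    have h1 : |diff φ (x, x + h)| ≤ B := by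
      refine (abs_sub _ _).trans (le_trans ?_ (le_max_left _ _))
      linarith [hM x, hM (x + h)]
    have h2 : |diff φ (x, x + h)| ≤ B * ‖h‖ := by
      refine (hC _ _).trans ?_
      simp only [sub_add_cancel_left, norm_neg]
      gcongr
      exact le_max_right _ _
    exact le_min (sq_le_sq' (abs_le.1 h1).1 (abs_le.1 h1).2)
      (sq_le_sq' (abs_le.1 h2).1 (abs_le.1 h2).2)
  calc _ ≤ ∫⁻ h, 3 * volume (tsupport φ) *
        (ENNReal.ofReal (B ^ 2) * ENNReal.ofReal (min 1 (‖h‖ ^ 2))) ∂incMeas := by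
        refine lintegral_mono fun h => ?_
        refine lintegral_le_of_translates (isClosed_tsupport _).measurableSet h (hpt · h) ?_
        intro x h1 h2 _
        simp [diff, image_eq_zero_of_notMem_tsupport h1, image_eq_zero_of_notMem_tsupport h2]
    _ = 3 * volume (tsupport φ) * ENNReal.ofReal (B ^ 2) *
        ∫⁻ h, ENNReal.ofReal (min 1 (‖h‖ ^ 2)) ∂incMeas := by
        rw [← lintegral_const_mul' _ _ (by finiteness)]
        simp only [mul_assoc]
    _ < ∞ := by
        have := lintegral_min_sq_lt_top
        finiteness

/-! ### The Hilbert space of difference functions -/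

/-- Square integrable functions for the Gagliardo measure. -/
abbrev GagL2 : Type := Lp ℝ 2 gagMeas

/-- The linear map sending a test function to its difference function. -/
def testDiff : Test →ₗ[ℝ] GagL2 where
  toFun φ := φ.memLp_diff.toLp
  map_add' φ ψ := by
    rw [← MemLp.toLp_add]
    congr 1
    ext z
    simp only [diff, FunLike.coe_add, Pi.add_apply]
    ring
  map_smul' c φ := by
    rw [RingHom.id_apply, ← MemLp.toLp_const_smul]
    congr 1
    ext z
    simp only [diff, FunLike.coe_smul, Pi.smul_apply, smul_eq_mul]
    ring

/-- The closed subspace of difference functions, a copy of the homogeneous Sobolev space. -/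
def hSpace : Submodule ℝ GagL2 := (LinearMap.range testDiff).topologicalClosure

theorem testDiff_mem (φ : Test) : testDiff φ ∈ hSpace :=
  Submodule.le_topologicalClosure _ ⟨φ, rfl⟩

theorem hHalfNorm_test (φ : Test) : hHalfNorm φ = ‖testDiff φ‖ := by
  rw [hHalfNorm_eq]
  exact (Lp.norm_toLp _ φ.memLp_diff).symm

/-! ### Riesz representatives of the dual space -/

/-- `f` is the Riesz representative of the distribution `ρ`. -/
structure HasRep (ρ : Plane → ℝ) (f : GagL2) : Prop where
  locallyIntegrable : LocallyIntegrable ρ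
  mem : f ∈ hSpace
  integral_eq : ∀ φ : Test, ∫ x, ρ x * φ x = inner ℝ f (testDiff φ)

theorem integrable_mul_test {ρ : Plane → ℝ} (hρ : LocallyIntegrable ρ) (φ : Test) :
    Integrable fun x => ρ x * φ x := by
  simpa only [smul_eq_mul, mul_comm] using
    hρ.integrable_smul_left_of_hasCompactSupport φ.continuous φ.hasCompactSupport

/-- The functional on test functions given by a locally integrable function. -/
def testFunctional {ρ : Plane → ℝ} (hρ : LocallyIntegrable ρ) : Test →ₗ[ℝ] ℝ where
  toFun φ := ∫ x, ρ x * φ x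
  map_add' φ ψ := by
    rw [← integral_add (integrable_mul_test hρ φ) (integrable_mul_test hρ ψ)]
    simp [mul_add]
  map_smul' c φ := by
    simp only [FunLike.coe_smul, Pi.smul_apply, smul_eq_mul, RingHom.id_apply,
      ← integral_const_mul]
    congr 1
    ext x
    ring

instance : CompleteSpace hSpace :=
  (Submodule.isClosed_topologicalClosure _).completeSpace_coe

/-- The difference map into the closed subspace `hSpace`. -/
def testDiffCod : Test →ₗ[ℝ] hSpace := testDiff.codRestrict hSpace testDiff_mem

theorem denseRange_testDiffCod : DenseRange testDiffCod := by
  intro x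
  rw [Topology.IsInducing.subtypeVal.closure_eq_preimage_closure_image, Set.mem_preimage,
    ← Set.range_comp]
  exact x.2

/-- The defining bound extends `φ ↦ ∫ ρ φ` continuously from the dense range of `testDiffCod` to all
of `hSpace`, where the Riesz representation theorem applies. -/
theorem MemHNegHalf.exists_rep {ρ : Plane → ℝ} (hρ : MemHNegHalf ρ) : ∃ f, HasRep ρ f := by
  obtain ⟨hl, C, hC⟩ := hρ
  have hb : ∃ C, ∀ φ, ‖testFunctional hl φ‖ ≤ C * ‖testDiffCod φ‖ := by
    refine ⟨C, fun φ => ?_⟩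
    have := hC φ
    rwa [hHalfNorm_test] at this
  set T : hSpace →L[ℝ] ℝ := (testFunctional hl).extendOfNorm testDiffCod
  refine ⟨((InnerProductSpace.toDual ℝ hSpace).symm T : hSpace), hl, Subtype.mem _, fun φ => ?_⟩
  have h1 : inner ℝ ((InnerProductSpace.toDual ℝ hSpace).symm T) (testDiffCod φ) =
      T (testDiffCod φ) := InnerProductSpace.toDual_symm_apply
  rw [LinearMap.extendOfNorm_eq denseRange_testDiffCod hb] at h1
  exact h1.symm

theorem inner_le_of_test {f : GagL2} {b : ℝ}
    (h : ∀ φ : Test, |inner ℝ f (testDiff φ)| ≤ b * ‖testDiff φ‖) {g : GagL2} (hg : g ∈ hSpace) :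
    |inner ℝ f g| ≤ b * ‖g‖ := by
  have hcl : IsClosed {g : GagL2 | |inner ℝ f g| ≤ b * ‖g‖} :=
    isClosed_le (by fun_prop) (by fun_prop)
  refine closure_minimal ?_ hcl hg
  rintro _ ⟨φ, rfl⟩
  exact h φ

theorem hHalfNorm_zero_le : hHalfNorm (0 : Test) ≤ 1 := by
  rw [hHalfNorm_test, map_zero, norm_zero]
  exact zero_le_one

namespace HasRep

variable {ρ σ : Plane → ℝ} {f g : GagL2}

theorem memHNegHalf (h : HasRep ρ f) : MemHNegHalf ρ := by
  refine ⟨h.locallyIntegrable, ‖f‖, fun φ => ?_⟩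
  rw [h.integral_eq, hHalfNorm_test]
  exact abs_real_inner_le_norm _ _

theorem add (h : HasRep ρ f) (h' : HasRep σ g) : HasRep (fun x => ρ x + σ x) (f + g) where
  locallyIntegrable := h.locallyIntegrable.add h'.locallyIntegrable
  mem := add_mem h.mem h'.mem
  integral_eq φ := by
    rw [inner_add_left, ← h.integral_eq, ← h'.integral_eq, ← integral_add
      (integrable_mul_test h.locallyIntegrable φ) (integrable_mul_test h'.locallyIntegrable φ)]
    simp only [add_mul]

theorem const_mul (c : ℝ) (h : HasRep ρ f) : HasRep (fun x => c * ρ x) (c • f) where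
  locallyIntegrable := h.locallyIntegrable.smul c
  mem := Submodule.smul_mem _ _ h.mem
  integral_eq φ := by
    rw [real_inner_smul_left, ← h.integral_eq, ← integral_const_mul]
    simp only [mul_assoc]

theorem sub (h : HasRep ρ f) (h' : HasRep σ g) : HasRep (fun x => ρ x - σ x) (f - g) := by
  have := h.add (h'.const_mul (-1))
  simpa only [neg_one_mul, neg_one_smul, ← sub_eq_add_neg] using this

/-- Cauchy–Schwarz gives one bound. For the other, a bound valid on test functions passes to their
closure `hSpace`, which contains `f`, and is then evaluated at `f` itself. -/
theorem hNegHalfNorm_eq (h : HasRep ρ f) : hNegHalfNorm ρ = ‖f‖ := by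
  refine IsLUB.csSup_eq ⟨?_, ?_⟩ ⟨0, 0, hHalfNorm_zero_le, by simp⟩
  · rintro r ⟨φ, hφ, rfl⟩
    rw [hHalfNorm_test] at hφ
    rw [h.integral_eq]
    refine (abs_real_inner_le_norm _ _).trans ?_
    exact mul_le_of_le_one_right (norm_nonneg _) hφ
  · intro b hb
    have hb0 : 0 ≤ b := hb ⟨0, hHalfNorm_zero_le, by simp⟩
    have h1 : ∀ φ : Test, |inner ℝ f (testDiff φ)| ≤ b * ‖testDiff φ‖ := fun φ => by
      by_cases h0 : ‖testDiff φ‖ = 0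
      · simp [norm_eq_zero.1 h0]
      have h2 : |∫ x, ρ x * (‖testDiff φ‖⁻¹ • φ : Test) x| ≤ b := by
        refine hb ⟨_, ?_, rfl⟩
        rw [hHalfNorm_test, map_smul, norm_smul, norm_inv, norm_norm, inv_mul_cancel₀ h0]
      rw [h.integral_eq, map_smul, real_inner_smul_right, abs_mul, abs_inv, abs_norm,
        inv_mul_le_iff₀ (lt_of_le_of_ne (norm_nonneg _) (Ne.symm h0))] at h2
      rwa [mul_comm]
    have h2 := inner_le_of_test h1 h.mem
    rw [real_inner_self_eq_norm_sq, abs_sq, sq] at h2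
    by_contra! hlt
    nlinarith [norm_nonneg f]

theorem hNegHalfInner_eq (h : HasRep ρ f) (h' : HasRep σ g) : hNegHalfInner ρ σ = inner ℝ f g := by
  rw [hNegHalfInner, (h.add h').hNegHalfNorm_eq, (h.sub h').hNegHalfNorm_eq,
    norm_add_sq_real, norm_sub_sq_real]
  ring

end HasRep

/-! ### Functions with a difference function in the closed subspace -/

/-- `u` has a difference function in `hSpace`. -/
structure HasDiff (u : Plane → ℝ) : Prop where
  memLp : MemLp (diff u) 2 gagMeas
  mem : memLp.toLp ∈ hSpace

theorem HasDiff.test (φ : Test) : HasDiff φ := ⟨φ.memLp_diff, testDiff_mem φ⟩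

theorem edist_toLp_diff {u v : Plane → ℝ} (hu : MemLp (diff u) 2 gagMeas)
    (hv : MemLp (diff v) 2 gagMeas) :
    edist hu.toLp hv.toLp = gagliardoSq (fun x => u x - v x) ^ (1 / 2 : ℝ) := by
  rw [Lp.edist_toLp_toLp, gagliardoSq_eq, ← ENNReal.rpow_natCast, ← ENNReal.rpow_mul]
  norm_num
  congr 1
  ext z
  simp only [diff, Pi.sub_apply]
  ring

theorem tendsto_toLp_diff {ι : Type*} {l : Filter ι} {u : Plane → ℝ} {v : ι → Plane → ℝ}
    (hu : MemLp (diff u) 2 gagMeas) (hv : ∀ i, MemLp (diff (v i)) 2 gagMeas)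
    (h : Tendsto (fun i => gagliardoSq (fun x => u x - v i x)) l (𝓝 0)) :
    Tendsto (fun i => (hv i).toLp) l (𝓝 hu.toLp) := by
  rw [tendsto_iff_edist_tendsto_0]
  have := (ENNReal.continuous_rpow_const (y := 1 / 2)).tendsto 0 |>.comp h
  rw [ENNReal.zero_rpow_of_pos (by norm_num)] at this
  refine this.congr fun i => ?_
  rw [edist_comm, edist_toLp_diff, Function.comp]

theorem memLp_diff_of_tendsto {u : Plane → ℝ} {v : ℕ → Plane → ℝ}
    (hu : AEStronglyMeasurable u) (hv : ∀ i, MemLp (diff (v i)) 2 gagMeas)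
    (h : Tendsto (fun i => gagliardoSq (fun x => u x - v i x)) atTop (𝓝 0)) :
    MemLp (diff u) 2 gagMeas := by
  -- A single approximant at finite Gagliardo distance suffices.
  obtain ⟨n, hn⟩ := (h.eventually (gt_mem_nhds ENNReal.zero_lt_top)).exists
  rw [gagliardoSq_eq] at hn
  have hm := aestronglyMeasurable_diff hu
  have h1 : diff (fun x => u x - v n x) = diff u - diff (v n) := by
    ext z; simp only [diff, Pi.sub_apply]; ring
  have h2 : MemLp (diff (fun x => u x - v n x)) 2 gagMeas :=
    ⟨h1 ▸ hm.sub (hv n).1, by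
      by_contra h3
      rw [not_lt_top_iff] at h3
      simp [h3] at hn⟩
  have h3 : diff u = diff (fun x => u x - v n x) + diff (v n) := by rw [h1]; abel
  rw [h3]
  exact h2.add (hv n)

theorem HasDiff.of_tendsto {u : Plane → ℝ} {v : ℕ → Plane → ℝ}
    (hu : AEStronglyMeasurable u) (hv : ∀ i, HasDiff (v i))
    (h : Tendsto (fun i => gagliardoSq (fun x => u x - v i x)) atTop (𝓝 0)) : HasDiff u := by
  have hm := memLp_diff_of_tendsto hu (fun i => (hv i).memLp) h
  refine ⟨hm, ?_⟩
  exact (Submodule.isClosed_topologicalClosure _).mem_of_tendsto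
    (tendsto_toLp_diff hm (fun i => (hv i).memLp) h) (Eventually.of_forall fun i => (hv i).mem)

theorem MemHHalf.hasDiff {u : Plane → ℝ} (hu : MemHHalf u) : HasDiff u := by
  obtain ⟨hu4, φ, hφ, -⟩ := hu
  exact HasDiff.of_tendsto hu4.1 (fun n => HasDiff.test (φ n)) hφ

theorem MemHHalf.sub {u v : Plane → ℝ} (hu : MemHHalf u) (hv : MemHHalf v) :
    MemHHalf (fun x => u x - v x) := by
  have hud := hu.hasDiff.memLp
  have hvd := hv.hasDiff.memLp
  obtain ⟨hu4, φ, hφ, hφ4⟩ := hu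
  obtain ⟨hv4, ψ, hψ, hψ4⟩ := hv
  refine ⟨hu4.sub hv4, fun n => φ n - ψ n, ?_, ?_⟩
  · have h1 := (tendsto_toLp_diff hud (fun n => (φ n).memLp_diff) hφ).sub
      (tendsto_toLp_diff hvd (fun n => (ψ n).memLp_diff) hψ)
    have h2 : Tendsto (fun n => eLpNorm (diff fun x => (u x - v x) - (φ n - ψ n) x) 2 gagMeas)
        atTop (𝓝 0) := by
      rw [tendsto_iff_edist_tendsto_0] at h1
      refine h1.congr fun n => ?_
      rw [← MemLp.toLp_sub, ← MemLp.toLp_sub, edist_comm, Lp.edist_toLp_toLp]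
      congr 1
      ext z
      simp only [diff, Pi.sub_apply, FunLike.coe_sub]
      ring
    simp only [gagliardoSq_eq]
    have h3 := (ENNReal.continuous_pow 2).tendsto 0 |>.comp h2
    simpa using! h3
  · have h1 := hφ4.add hψ4
    rw [add_zero] at h1
    refine tendsto_of_tendsto_of_tendsto_of_le_of_le tendsto_const_nhds h1
      (fun n => zero_le) (fun n => ?_)
    have hA : AEStronglyMeasurable (fun x => u x - φ n x) volume := (hu4.sub ((φ n).memLp 4)).1
    have hB : AEStronglyMeasurable (fun x => v x - ψ n x) volume := (hv4.sub ((ψ n).memLp 4)).1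
    refine le_trans (le_of_eq ?_) (eLpNorm_sub_le hA hB (by norm_num))
    congr 1
    ext x
    simp only [Pi.sub_apply, FunLike.coe_sub]
    ring

theorem HasRep.tendsto_integral {ρ u : Plane → ℝ} {f : GagL2} (h : HasRep ρ f)
    (hu : MemLp (diff u) 2 gagMeas) {ι : Type*} {l : Filter ι} {φ : ι → Test}
    (hφ : Tendsto (fun i => gagliardoSq (fun x => u x - φ i x)) l (𝓝 0)) :
    Tendsto (fun i => ∫ x, ρ x * φ i x) l (𝓝 (inner ℝ f hu.toLp)) := by
  simp only [h.integral_eq]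
  exact tendsto_const_nhds.inner (tendsto_toLp_diff hu (fun i => (φ i).memLp_diff) hφ)

/-- The limit in `hPair` is meaningful because the approximating sequence of `u` makes the filter
nontrivial; its value follows from continuity of the inner product. -/
theorem HasRep.hPair_eq {ρ u : Plane → ℝ} {f : GagL2} (h : HasRep ρ f) (hu : MemHHalf u) :
    hPair ρ u = inner ℝ f hu.hasDiff.memLp.toLp := by
  have hne : (comap (fun φ : Test => gagliardoSq (fun x => u x - φ x)) (𝓝 0)).NeBot := by
    obtain ⟨-, φ, hφ, -⟩ := hu
    have : Tendsto φ atTop (comap (fun φ : Test => gagliardoSq (fun x => u x - φ x)) (𝓝 0)) :=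
      tendsto_comap_iff.2 hφ
    exact this.neBot
  exact (h.tendsto_integral hu.hasDiff.memLp tendsto_comap).limUnder_eq

/-! ### Pairing of Lebesgue spaces -/

instance holderTriple_three_halves_three : ENNReal.HolderTriple (3 / 2) 3 1 where
  inv_add_inv_eq_inv := by
    rw [ENNReal.inv_div (by simp) (by simp), ← one_div (3 : ℝ≥0∞), ENNReal.div_add_div_same, inv_one]
    norm_num
    exact ENNReal.div_self (by simp) (by simp)

instance holderTriple_four_thirds_four : ENNReal.HolderTriple (4 / 3) 4 1 where
  inv_add_inv_eq_inv := by
    rw [ENNReal.inv_div (by simp) (by simp), ← one_div (4 : ℝ≥0∞), ENNReal.div_add_div_same, inv_one]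
    norm_num
    exact ENNReal.div_self (by simp) (by simp)

section Holder

variable {α : Type*} [MeasurableSpace α] {μ : Measure α} {p q : ℝ≥0∞} [ENNReal.HolderTriple p q 1]

theorem integrable_mul_of_memLp {a b : α → ℝ} (ha : MemLp a p μ) (hb : MemLp b q μ) :
    Integrable (fun x => a x * b x) μ :=
  memLp_one_iff_integrable.1 (hb.mul' ha)

theorem abs_integral_mul_le {a b : α → ℝ} (ha : MemLp a p μ) (hb : MemLp b q μ) :
    |∫ x, a x * b x ∂μ| ≤ (eLpNorm a p μ).toReal * (eLpNorm b q μ).toReal := by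
  have h1 : eLpNorm (fun x => a x * b x) 1 μ ≤ eLpNorm a p μ * eLpNorm b q μ :=
    eLpNorm_smul_le_mul_eLpNorm (f := b) (φ := a) hb.1 ha.1
  rw [← ENNReal.toReal_mul, ← Real.norm_eq_abs]
  refine (norm_integral_le_lintegral_norm _).trans ?_
  refine ENNReal.toReal_mono (ENNReal.mul_ne_top ha.2.ne hb.2.ne) ?_
  rw [eLpNorm_one_eq_lintegral_enorm] at h1
  simpa only [ofReal_norm] using h1

theorem tendsto_integral_mul {ι : Type*} {l : Filter ι} {a : ι → α → ℝ} {b : ι → α → ℝ}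
    {a' b' : α → ℝ} (ha : ∀ i, MemLp (a i) p μ) (hb : ∀ i, MemLp (b i) q μ)
    (ha' : MemLp a' p μ) (hb' : MemLp b' q μ)
    (hla : Tendsto (fun i => eLpNorm (a i - a') p μ) l (𝓝 0))
    (hlb : Tendsto (fun i => eLpNorm (b i - b') q μ) l (𝓝 0)) :
    Tendsto (fun i => ∫ x, a i x * b i x ∂μ) l (𝓝 (∫ x, a' x * b' x ∂μ)) := by
  have hra := (ENNReal.tendsto_toReal (by simp)).comp hla
  have hrb := (ENNReal.tendsto_toReal (by simp)).comp hlb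
  rw [tendsto_iff_norm_sub_tendsto_zero]
  have hlim : Tendsto (fun i => (eLpNorm (a i - a') p μ).toReal * (eLpNorm (b i - b') q μ).toReal +
      (eLpNorm (a i - a') p μ).toReal * (eLpNorm b' q μ).toReal +
      (eLpNorm a' p μ).toReal * (eLpNorm (b i - b') q μ).toReal) l (𝓝 0) := by
    have := ((hra.mul hrb).add (hra.mul_const (eLpNorm b' q μ).toReal)).add
      (hrb.const_mul (eLpNorm a' p μ).toReal)
    simpa using! this
  refine squeeze_zero (fun i => norm_nonneg _) (fun i => ?_) hlim
  have hda := (ha i).sub ha'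
  have hdb := (hb i).sub hb'
  have hadd : Integrable (fun x => (a i - a') x * (b i - b') x + (a i - a') x * b' x) μ :=
    (integrable_mul_of_memLp hda hdb).add (integrable_mul_of_memLp hda hb')
  have heq : ∫ x, a i x * b i x ∂μ - ∫ x, a' x * b' x ∂μ =
      ∫ x, (a i - a') x * (b i - b') x ∂μ + ∫ x, (a i - a') x * b' x ∂μ +
        ∫ x, a' x * (b i - b') x ∂μ := by
    rw [← integral_sub (integrable_mul_of_memLp (ha i) (hb i)) (integrable_mul_of_memLp ha' hb'),
      ← integral_add (integrable_mul_of_memLp hda hdb) (integrable_mul_of_memLp hda hb'),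
      ← integral_add hadd (integrable_mul_of_memLp ha' hdb)]
    congr 1
    ext x
    simp only [Pi.sub_apply]
    ring
  rw [heq, Real.norm_eq_abs]
  refine (abs_add_three _ _ _).trans ?_
  gcongr
  · exact abs_integral_mul_le hda hdb
  · exact abs_integral_mul_le hda hb'
  · exact abs_integral_mul_le ha' hdb

end Holder

theorem eLpNorm_sub_swap {u v : Plane → ℝ} {p : ℝ≥0∞} :
    eLpNorm (fun x => u x - v x) p volume = eLpNorm (v - u) p volume :=
  eLpNorm_sub_comm _ _ _ _

/-! ### Density of test functions in intersections -/

theorem gagliardoSq_eq_lintegral_inc {u : Plane → ℝ} (hu : AEStronglyMeasurable u) :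
    gagliardoSq u = ∫⁻ h, eLpNorm (fun x => u x - u (x + h)) 2 ^ 2 ∂incMeas := by
  rw [gagliardoSq_eq_lintegral, lintegral_gagMeas ((aestronglyMeasurable_diff hu).enorm.pow_const _)]
  refine lintegral_congr fun h => ?_
  rw [eLpNorm_eq_lintegral_rpow_enorm_toReal (by simp) (by simp),
    ENNReal.toReal_ofNat, ← ENNReal.rpow_natCast, ← ENNReal.rpow_mul]
  norm_num
  rfl

theorem aemeasurable_eLpNorm_inc {u : Plane → ℝ} (hu : AEStronglyMeasurable u) :
    AEMeasurable (fun h => eLpNorm (fun x => u x - u (x + h)) 2 ^ 2) incMeas := by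
  have h1 : AEMeasurable (fun z => ‖diff u z‖ₑ ^ (2 : ℝ)) gagMeas :=
    (aestronglyMeasurable_diff hu).enorm.pow_const _
  rw [← measurePreserving_shear.map_eq] at h1
  have h2 := (h1.comp_measurable measurePreserving_shear.measurable).lintegral_prod_right'
  refine h2.congr (Eventually.of_forall fun h => ?_)
  simp only
  rw [eLpNorm_eq_lintegral_rpow_enorm_toReal (by simp) (by simp),
    ENNReal.toReal_ofNat, ← ENNReal.rpow_natCast, ← ENNReal.rpow_mul]
  norm_num
  rfl

theorem moll_comp_add_right (n : ℕ) (g : Plane → ℝ) (h x : Plane) :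
    moll n (fun y => g (y + h)) x = moll n g (x + h) := by
  rw [moll_apply, moll_apply]
  congr 1
  ext t
  rw [add_sub_right_comm]

/-- The squared Gagliardo norm integrates the squared `L²` norms of the increments over `incMeas`.
Mollification commutes with translations, so each increment is itself mollified and converges in
`L²`; dominated convergence in `h` concludes. -/
theorem tendsto_gagliardoSq_sub_moll {g : Plane → ℝ} (hg : MemLp g 2)
    (hd : MemLp (diff g) 2 gagMeas) :
    Tendsto (fun n => gagliardoSq (fun x => g x - moll n g x)) atTop (𝓝 0) := by
  have hgl := hg.locallyIntegrable (by norm_num)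
  have hm : ∀ n, AEStronglyMeasurable (fun x => g x - moll n g x) volume := fun n =>
    hg.1.sub (memLp_moll n hg (by norm_num) (by simp)).1
  have hsh : ∀ h, MemLp (fun x => g (x + h)) 2 volume := fun h =>
    hg.comp_measurePreserving (measurePreserving_add_right volume h)
  have hF : ∀ h, MemLp (fun x => g x - g (x + h)) 2 volume := fun h => hg.sub (hsh h)
  have heq : ∀ n h, (fun x => (g x - moll n g x) - (g (x + h) - moll n g (x + h))) =
      fun x => (fun x => g x - g (x + h)) x - moll n (fun x => g x - g (x + h)) x := by
    intro n h
    have h1 := moll_sub n hgl ((hsh h).locallyIntegrable (by norm_num))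
    ext x
    have h2 := congrFun h1 x
    simp only [Pi.sub_apply, moll_comp_add_right] at h2
    have h3 : moll n (fun x => g x - g (x + h)) x = moll n g x - moll n g (x + h) := h2
    rw [h3]
    ring
  simp only [gagliardoSq_eq_lintegral_inc (hm _)]
  have hlim : ∀ h, Tendsto (fun n => eLpNorm (fun x => (g x - moll n g x) -
      (g (x + h) - moll n g (x + h))) 2 volume ^ 2) atTop (𝓝 0) := by
    intro h
    have h1 := tendsto_eLpNorm_moll_sub (hF h) (by norm_num) (by simp)
    have h2 := (ENNReal.continuous_pow 2).tendsto 0 |>.comp h1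
    rw [zero_pow two_ne_zero] at h2
    refine h2.congr fun n => ?_
    rw [heq n h, eLpNorm_sub_swap, Function.comp]
  have hdct := tendsto_lintegral_of_dominated_convergence' (μ := incMeas)
    (F := fun n h => eLpNorm (fun x => (g x - moll n g x) -
      (g (x + h) - moll n g (x + h))) 2 volume ^ 2) (f := fun _ => 0)
    (fun h => 4 * eLpNorm (fun x => g x - g (x + h)) 2 volume ^ 2)
    (fun n => aemeasurable_eLpNorm_inc (hm n))
    (fun n => Eventually.of_forall fun h => ?_) ?_ (Eventually.of_forall hlim)
  · simpa using hdct
  · simp only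
    -- The factor `4 = 2 ^ 2` comes from `‖F - moll n F‖ ≤ 2 ‖F‖`, by contractivity.
    rw [heq n h, show (4 : ℝ≥0∞) = 2 ^ 2 by norm_num, ← mul_pow]
    gcongr
    refine (eLpNorm_sub_le (hF h).1 (memLp_moll n (hF h) (by norm_num) (by simp)).1
      (by norm_num)).trans ?_
    rw [two_mul]
    gcongr
    exact eLpNorm_moll_le n (hF h).1 (by norm_num) (by simp)
  · rw [lintegral_const_mul' _ _ (by simp), ← gagliardoSq_eq_lintegral_inc hg.1, gagliardoSq_eq]
    have := hd.2
    finiteness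

theorem HasRep.inner_eq_integral_of_compact {ρ g : Plane → ℝ} {f : GagL2} (h : HasRep ρ f)
    (hρ : MemLp ρ (3 / 2)) (hg : MemLp g 2) (hg3 : MemLp g 3) (hc : HasCompactSupport g)
    (hd : MemLp (diff g) 2 gagMeas) : inner ℝ f hd.toLp = ∫ x, ρ x * g x := by
  have hgl := hg.locallyIntegrable (by norm_num)
  have h1 := h.tendsto_integral hd (φ := fun n => mollTest n g hgl hc)
    (tendsto_gagliardoSq_sub_moll hg hd)
  refine tendsto_nhds_unique h1 ?_
  refine tendsto_integral_mul (p := 3 / 2) (q := 3) (fun _ => hρ)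
    (fun n => memLp_moll n hg3 (by norm_num) (by simp)) hρ hg3 (by simp)
    (tendsto_eLpNorm_moll_sub hg3 (by norm_num) (by simp))

/-- Dominated convergence with an error term converging in `L²`. -/
theorem tendsto_eLpNorm_two_zero {α : Type*} [MeasurableSpace α] {μ : Measure α}
    {a e : ℕ → α → ℝ} {b : α → ℝ} (ha : ∀ n, AEStronglyMeasurable (a n) μ)
    (he : ∀ n, AEStronglyMeasurable (e n) μ) (hb : MemLp b 2 μ)
    (hab : ∀ n, ∀ᵐ x ∂μ, |a n x| ≤ |b x| + |e n x|)
    (hlim : ∀ᵐ x ∂μ, Tendsto (fun n => a n x) atTop (𝓝 0))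
    (hel : Tendsto (fun n => ∫⁻ x, ‖e n x‖ₑ ^ (2 : ℝ) ∂μ) atTop (𝓝 0)) :
    Tendsto (fun n => ∫⁻ x, ‖a n x‖ₑ ^ (2 : ℝ) ∂μ) atTop (𝓝 0) := by
  have hb2 : ∫⁻ x, ‖b x‖ₑ ^ (2 : ℝ) ∂μ ≠ ∞ := by
    have := hb.2
    rw [eLpNorm_lt_top_iff_lintegral_rpow_enorm_lt_top (by simp) (by simp),
      ENNReal.toReal_ofNat] at this
    exact this.ne
  -- The truncated difference `‖a n‖ₑ - ‖e n‖ₑ` is dominated by `‖b‖ₑ` and still tends to zero; the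
  -- removed part is controlled by the convergence of `e n`.
  have hdct := tendsto_lintegral_of_dominated_convergence' (μ := μ)
    (F := fun n x => (‖a n x‖ₑ - ‖e n x‖ₑ) ^ (2 : ℝ)) (f := fun _ => 0)
    (fun x => ‖b x‖ₑ ^ (2 : ℝ)) (fun n => ((ha n).enorm.sub (he n).enorm).pow_const _)
    (fun n => ?_) hb2 ?_
  · rw [lintegral_zero] at hdct
    have hsum := ENNReal.Tendsto.const_mul (a := 2) (hdct.add hel) (Or.inr (by simp))
    rw [add_zero, mul_zero] at hsum
    refine tendsto_of_tendsto_of_tendsto_of_le_of_le tendsto_const_nhds hsum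
      (fun n => zero_le) (fun n => ?_)
    simp only
    rw [← lintegral_add_right' _ ((he n).enorm.pow_const _), ← lintegral_const_mul' _ _ (by simp)]
    refine lintegral_mono fun x => ?_
    have h1 : ‖a n x‖ₑ ≤ (‖a n x‖ₑ - ‖e n x‖ₑ) + ‖e n x‖ₑ := le_tsub_add
    refine (ENNReal.rpow_le_rpow h1 (by norm_num)).trans ?_
    refine (ENNReal.rpow_add_le_mul_rpow_add_rpow _ _ (by norm_num)).trans ?_
    norm_num
  · filter_upwards [hab n] with x hx
    gcongr
    rw [tsub_le_iff_right, Real.enorm_eq_ofReal_abs, Real.enorm_eq_ofReal_abs,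
      Real.enorm_eq_ofReal_abs, ← ENNReal.ofReal_add (abs_nonneg _) (abs_nonneg _)]
    exact ENNReal.ofReal_le_ofReal hx
  · filter_upwards [hlim] with x hx
    have h1 : Tendsto (fun n => ‖a n x‖ₑ ^ (2 : ℝ)) atTop (𝓝 0) := by
      have := (ENNReal.continuous_rpow_const (y := 2)).tendsto _ |>.comp hx.enorm
      simpa using! this
    refine tendsto_of_tendsto_of_tendsto_of_le_of_le tendsto_const_nhds h1
      (fun n => zero_le) (fun n => ?_)
    exact ENNReal.rpow_le_rpow tsub_le_self (by norm_num)

/-- Truncation of `a` at the levels `± |w|`. -/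
def trunc (a w : ℝ) : ℝ := max (-|w|) (min a |w|)

theorem trunc_self (w : ℝ) : trunc w w = w := by
  rw [trunc, min_eq_left (le_abs_self w), max_eq_right (neg_abs_le w)]

theorem abs_trunc_le_left (a w : ℝ) : |trunc a w| ≤ |a| := by
  rw [trunc, abs_le]
  have := abs_nonneg w
  refine ⟨?_, ?_⟩
  · refine le_max_of_le_right (le_min (neg_abs_le a) ?_)
    linarith [abs_nonneg a]
  · exact max_le (by linarith [abs_nonneg a]) (min_le_of_left_le (le_abs_self a))

theorem abs_trunc_le_right (a w : ℝ) : |trunc a w| ≤ |w| := by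
  rw [trunc, abs_le]
  have := abs_nonneg w
  exact ⟨le_max_left _ _, max_le (by linarith) (min_le_right _ _)⟩

/-- Lipschitz continuity for the maximum norm: the difference function of a truncation is bounded by
those of its two arguments, which keeps the Gagliardo norm under control. -/
theorem abs_trunc_sub_trunc_le (a w a' w' : ℝ) :
    |trunc a w - trunc a' w'| ≤ max |a - a'| |w - w'| := by
  have h1 : |(|w| - |w'|)| ≤ |w - w'| := abs_abs_sub_abs_le_abs_sub w w'
  refine (abs_max_sub_max_le_max _ _ _ _).trans (max_le ?_ ?_)
  · rw [neg_sub_neg, abs_sub_comm]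
    exact h1.trans (le_max_right _ _)
  · exact (abs_min_sub_min_le_max _ _ _ _).trans (max_le_max le_rfl h1)

theorem continuous_trunc : Continuous fun z : ℝ × ℝ => trunc z.1 z.2 := by
  unfold trunc; fun_prop

/-- Convergence of test functions to `W` in the Gagliardo norm and in `L⁴` does not control `∫ ρ φ`
for `ρ` in `L^{3/2}`. Truncation at `± |W|` restores a dominating function without losing Gagliardo
convergence. -/
theorem HasRep.inner_eq_integral {ρ W : Plane → ℝ} {f : GagL2} (h : HasRep ρ f)
    (hρ : MemLp ρ (3 / 2)) (hW : MemHHalf W) (hW3 : MemLp W 3) :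
    inner ℝ f hW.hasDiff.memLp.toLp = ∫ x, ρ x * W x := by
  have hWd := hW.hasDiff.memLp
  obtain ⟨hW4, φ₀, hφ₀, hφ₀4⟩ := hW
  have hmeas : TendstoInMeasure volume (fun n => (φ₀ n : Plane → ℝ)) atTop W := by
    refine tendstoInMeasure_of_tendsto_eLpNorm (p := 4) (by simp)
      (fun n => (φ₀ n).continuous.aestronglyMeasurable) hW4.1 ?_
    refine hφ₀4.congr fun n => ?_
    rw [eLpNorm_sub_swap]
  obtain ⟨ns, hns, hae⟩ := hmeas.exists_seq_tendsto_ae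
  set φ : ℕ → Test := fun k => φ₀ (ns k)
  have hφ : Tendsto (fun n => gagliardoSq (fun x => W x - φ n x)) atTop (𝓝 0) :=
    hφ₀.comp hns.tendsto_atTop
  -- The bound by `|φ n|` gives compact support and membership in every `L^p`; the bound by `|W|`
  -- gives domination.
  set g : ℕ → Plane → ℝ := fun n x => trunc (φ n x) (W x)
  have hgm : ∀ n, AEStronglyMeasurable (g n) volume := fun n =>
    continuous_trunc.comp_aestronglyMeasurable
      ((φ n).continuous.aestronglyMeasurable.prodMk hW4.1)
  have hgp : ∀ n p, MemLp (g n) p volume := fun n p =>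
    ((φ n).memLp p).mono (hgm n) (Eventually.of_forall fun x => abs_trunc_le_left _ _)
  have hgc : ∀ n, HasCompactSupport (g n) := fun n => by
    refine (φ n).hasCompactSupport.mono fun x hx hx0 => hx ?_
    have : |g n x| ≤ |φ n x| := abs_trunc_le_left (φ n x) (W x)
    rw [hx0, abs_zero] at this
    exact abs_nonpos_iff.1 this
  have hgd : ∀ n, MemLp (diff (g n)) 2 gagMeas := fun n => by
    refine (((φ n).memLp_diff).norm.add hWd.norm).mono (aestronglyMeasurable_diff (hgm n))
      (Eventually.of_forall fun z => ?_)
    simp only [Pi.add_apply, Real.norm_eq_abs]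
    rw [abs_of_nonneg (by positivity : 0 ≤ |diff (φ n) z| + |diff W z|)]
    exact (abs_trunc_sub_trunc_le _ _ _ _).trans
      (max_le_add_of_nonneg (abs_nonneg _) (abs_nonneg _))
  have hglim : ∀ᵐ x, Tendsto (fun n => g n x) atTop (𝓝 (W x)) := by
    filter_upwards [hae] with x hx
    have h1 := (continuous_trunc.tendsto (W x, W x)).comp (hx.prodMk_nhds tendsto_const_nhds)
    simpa only [trunc_self] using! h1
  -- The differences of `W - g n` are at most `2 |diff W|` plus the differences of `W - φ n`, which
  -- vanish in `L²`; pointwise they tend to zero almost everywhere.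
  have hG : Tendsto (fun n => gagliardoSq (fun x => W x - g n x)) atTop (𝓝 0) := by
    simp only [gagliardoSq_eq_lintegral] at hφ ⊢
    have hb2 : MemLp (fun z => 2 * diff W z) 2 gagMeas := hWd.const_mul 2
    refine tendsto_eLpNorm_two_zero (fun n => aestronglyMeasurable_diff (hW4.1.sub (hgm n)))
      (fun n => aestronglyMeasurable_diff (hW4.1.sub (φ n).continuous.aestronglyMeasurable))
      hb2 (fun n => Eventually.of_forall fun z => ?_) ?_ hφ
    · have h1 := abs_trunc_sub_trunc_le (φ n z.1) (W z.1) (φ n z.2) (W z.2)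
      have h2 : |diff (fun x => W x - g n x) z| ≤ |diff W z| + |diff (g n) z| := by
        have : diff (fun x => W x - g n x) z = diff W z - diff (g n) z := by
          simp only [diff]; ring
        rw [this]
        exact abs_sub _ _
      have h3 : |diff (φ n) z| ≤ |diff W z| + |diff (fun x => W x - φ n x) z| := by
        have : diff (φ n) z = diff W z - diff (fun x => W x - φ n x) z := by
          simp only [diff]; ring
        rw [this]
        exact abs_sub _ _
      have h4 : |diff (g n) z| ≤ |diff W z| + |diff (fun x => W x - φ n x) z| :=
        h1.trans (max_le h3 (le_add_of_nonneg_right (abs_nonneg _)))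
      change _ ≤ |2 * diff W z| + |diff (fun x => W x - φ n x) z|
      rw [abs_mul, abs_two]
      linarith
    · filter_upwards [ae_gagMeas_of_ae hglim] with z hz
      have h1 := (hz.1.const_sub (W z.1)).sub (hz.2.const_sub (W z.2))
      simpa only [sub_self, sub_zero] using! h1
  have hlim1 : Tendsto (fun n => ∫ x, ρ x * g n x) atTop (𝓝 (inner ℝ f hWd.toLp)) := by
    have := (tendsto_const_nhds (x := f)).inner (𝕜 := ℝ) (tendsto_toLp_diff hWd hgd hG)
    refine this.congr fun n => ?_
    exact h.inner_eq_integral_of_compact hρ (hgp n 2) (hgp n 3) (hgc n) (hgd n)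
  refine tendsto_nhds_unique hlim1 ?_
  refine tendsto_integral_of_dominated_convergence (fun x => |ρ x * W x|)
    (fun n => hρ.1.mul (hgm n)) (integrable_mul_of_memLp hρ hW3).abs
    (fun n => Eventually.of_forall fun x => ?_) ?_
  · rw [Real.norm_eq_abs, abs_mul, abs_mul]
    exact mul_le_mul_of_nonneg_left (abs_trunc_le_right _ _) (abs_nonneg _)
  · filter_upwards [hglim] with x hx
    exact hx.const_mul _

/-! ### The signed square root and convexity of `|a| ^ (3 / 2)` -/

/-- The signed square root. -/
def signedSqrt (a : ℝ) : ℝ := Real.sign a * |a| ^ (1 / 2 : ℝ)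

theorem signedSqrt_of_nonneg {a : ℝ} (ha : 0 ≤ a) : signedSqrt a = Real.sqrt a := by
  rcases ha.eq_or_lt with rfl | h
  · simp [signedSqrt]
  · rw [signedSqrt, Real.sign_of_pos h, abs_of_pos h, one_mul, Real.sqrt_eq_rpow]

theorem signedSqrt_neg (a : ℝ) : signedSqrt (-a) = - signedSqrt a := by
  rw [signedSqrt, signedSqrt, abs_neg, Real.sign_neg, neg_mul]

theorem abs_signedSqrt (a : ℝ) : |signedSqrt a| = Real.sqrt |a| := by
  rcases le_total 0 a with h | h
  · rw [signedSqrt_of_nonneg h, abs_of_nonneg h, abs_of_nonneg (Real.sqrt_nonneg _)]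
  · obtain ⟨b, rfl⟩ : ∃ b, a = -b := ⟨-a, by ring⟩
    have hb : 0 ≤ b := by linarith
    rw [signedSqrt_neg, signedSqrt_of_nonneg hb, abs_neg, abs_neg, abs_of_nonneg hb,
      abs_of_nonneg (Real.sqrt_nonneg _)]

/-- With `s = signedSqrt a`, `a = s |s|` and `|a| ^ (3 / 2) = |s| ^ 3`, so inequalities for the
fractional power become polynomial ones. -/
theorem signedSqrt_mul_abs (a : ℝ) : signedSqrt a * |signedSqrt a| = a := by
  rcases le_total 0 a with h | h
  · rw [abs_signedSqrt, signedSqrt_of_nonneg h, abs_of_nonneg h, Real.mul_self_sqrt h]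
  · obtain ⟨b, rfl⟩ : ∃ b, a = -b := ⟨-a, by ring⟩
    have hb : 0 ≤ b := by linarith
    rw [abs_signedSqrt, signedSqrt_neg, signedSqrt_of_nonneg hb, abs_neg, abs_of_nonneg hb,
      neg_mul, Real.mul_self_sqrt hb]

theorem abs_rpow_three_halves (a : ℝ) : |a| ^ (3 / 2 : ℝ) = |signedSqrt a| ^ 3 := by
  rw [abs_signedSqrt, Real.sqrt_eq_rpow, ← Real.rpow_natCast, ← Real.rpow_mul (abs_nonneg a)]
  norm_num

theorem abs_signedSqrt_sq (a : ℝ) : |signedSqrt a| ^ 2 = |a| := by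
  rw [abs_signedSqrt, Real.sq_sqrt (abs_nonneg a)]

theorem measurable_signedSqrt : Measurable signedSqrt := by
  have h : signedSqrt = fun a => if 0 ≤ a then Real.sqrt a else - Real.sqrt (-a) := by
    ext a
    split_ifs with h
    · exact signedSqrt_of_nonneg h
    · rw [← signedSqrt_of_nonneg (by linarith : 0 ≤ -a), signedSqrt_neg, neg_neg]
  rw [h]
  exact Measurable.ite measurableSet_Ici (by fun_prop) (by fun_prop)

/-- The polynomial form of `sq_sub_le_tangent`. For equal signs the two sides differ by `(|t| - |s|)
^ 2 * (|s| + |t|) * |t|`; for opposite signs the difference is a polynomial in `|s|`, `|t|` with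
nonnegative coefficients. -/
theorem sq_sub_le_mul_aux (s t : ℝ) : (t * |t| - s * |s|) ^ 2 ≤
    2 * (|s| + |t|) * (|t| ^ 3 + |s| ^ 3 / 2 - 3 / 2 * s * (t * |t|)) := by
  rcases abs_cases s with ⟨hs, hs'⟩ | ⟨hs, hs'⟩ <;> rcases abs_cases t with ⟨ht, ht'⟩ | ⟨ht, ht'⟩ <;>
    rw [hs, ht]
  · have : 2 * (s + t) * (t ^ 3 + s ^ 3 / 2 - 3 / 2 * s * (t * t)) - (t * t - s * s) ^ 2 =
        (t - s) ^ 2 * (s + t) * t := by ring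
    nlinarith [mul_nonneg (mul_nonneg (sq_nonneg (t - s)) (add_nonneg hs' ht')) ht']
  · obtain ⟨r, rfl⟩ : ∃ r, t = -r := ⟨-t, by ring⟩
    have hr : 0 ≤ r := by linarith
    have h1 : 0 ≤ s * r ^ 3 := by positivity
    have h2 : 0 ≤ s ^ 3 * r := by positivity
    have h3 : 0 ≤ s ^ 2 * r ^ 2 := by positivity
    have h4 : 0 ≤ r ^ 4 := by positivity
    ring_nf
    nlinarith
  · obtain ⟨r, rfl⟩ : ∃ r, s = -r := ⟨-s, by ring⟩
    have hr : 0 ≤ r := by linarith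
    have h1 : 0 ≤ t * r ^ 3 := by positivity
    have h2 : 0 ≤ t ^ 3 * r := by positivity
    have h3 : 0 ≤ t ^ 2 * r ^ 2 := by positivity
    have h4 : 0 ≤ t ^ 4 := by positivity
    ring_nf
    nlinarith
  · obtain ⟨r, rfl⟩ : ∃ r, s = -r := ⟨-s, by ring⟩
    obtain ⟨q, rfl⟩ : ∃ q, t = -q := ⟨-t, by ring⟩
    have hr : 0 ≤ r := by linarith
    have hq : 0 ≤ q := by linarith
    have := mul_nonneg (mul_nonneg (sq_nonneg (q - r)) (add_nonneg hr hq)) hq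
    ring_nf at this ⊢
    nlinarith

/-- Quantitative strict convexity of `|a| ^ (3 / 2)`, tangent form. -/
theorem sq_sub_le_tangent (a b : ℝ) : (b - a) ^ 2 ≤ 2 * (|signedSqrt a| + |signedSqrt b|) *
    (|b| ^ (3 / 2 : ℝ) - |a| ^ (3 / 2 : ℝ) - 3 / 2 * signedSqrt a * (b - a)) := by
  have h := sq_sub_le_mul_aux (signedSqrt a) (signedSqrt b)
  have h3 : signedSqrt a * a = |signedSqrt a| ^ 3 := by
    nth_rw 2 [← signedSqrt_mul_abs a]
    rw [← mul_assoc, ← abs_mul_abs_self]; ring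
  rw [signedSqrt_mul_abs, signedSqrt_mul_abs] at h
  rw [abs_rpow_three_halves, abs_rpow_three_halves]
  refine h.trans (le_of_eq ?_)
  linear_combination (-3) * (|signedSqrt a| + |signedSqrt b|) * h3

theorem tangent_le (a b : ℝ) :
    |a| ^ (3 / 2 : ℝ) + 3 / 2 * signedSqrt a * (b - a) ≤ |b| ^ (3 / 2 : ℝ) := by
  have h := sq_sub_le_tangent a b
  by_contra! hlt
  have h1 : 0 ≤ |signedSqrt a| + |signedSqrt b| := by positivity
  have h2 : (b - a) ^ 2 ≤ 0 := h.trans (by nlinarith)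
  have h3 : b = a := by nlinarith
  rw [h3] at hlt
  simp at hlt

theorem sq_sub_le_two_mul_abs_aux (s t : ℝ) : (t - s) ^ 2 ≤ 2 * |(t * |t| - s * |s|)| := by
  wlog hst : s ≤ t generalizing s t
  · have := this t s (le_of_not_ge hst)
    rwa [abs_sub_comm, ← neg_sub, neg_sq] at this
  refine le_trans ?_ (mul_le_mul_of_nonneg_left (le_abs_self _) zero_le_two)
  rcases abs_cases s with ⟨hs, hs'⟩ | ⟨hs, hs'⟩ <;> rcases abs_cases t with ⟨ht, ht'⟩ | ⟨ht, ht'⟩ <;>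
    rw [hs, ht]
  · nlinarith
  · nlinarith
  · nlinarith [sq_nonneg (t + s)]
  · nlinarith

theorem sq_signedSqrt_sub_le (a b : ℝ) : (signedSqrt b - signedSqrt a) ^ 2 ≤ 2 * |b - a| := by
  have := sq_sub_le_two_mul_abs_aux (signedSqrt a) (signedSqrt b)
  rwa [signedSqrt_mul_abs, signedSqrt_mul_abs] at this

/-- Upper bound for `|a + b| ^ (3 / 2)` by the first order expansion. -/
theorem abs_add_rpow_le (a b : ℝ) : |a + b| ^ (3 / 2 : ℝ) ≤
    |a| ^ (3 / 2 : ℝ) + 3 / 2 * signedSqrt a * b + 3 * |b| ^ (3 / 2 : ℝ) := by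
  -- The tangent inequality based at `a + b` bounds `|a + b| ^ (3 / 2)` from above, with slope at `a
  -- + b`. The Hölder bound moves the slope to `a` at the cost `3 / 2 * 2 |b| ^ (3 / 2)`.
  have h1 := tangent_le (a + b) a
  have h2 := sq_signedSqrt_sub_le a (a + b)
  rw [add_sub_cancel_left, ← abs_signedSqrt_sq b] at h2
  have h3 : |signedSqrt (a + b) - signedSqrt a| ≤ 2 * |signedSqrt b| := by
    refine abs_le_of_sq_le_sq ?_ (by positivity)
    nlinarith [sq_nonneg |signedSqrt b|]
  have h4 : (signedSqrt (a + b) - signedSqrt a) * b ≤ 2 * |signedSqrt b| * |b| := by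
    refine (le_abs_self _).trans ?_
    rw [abs_mul]
    gcongr
  rw [← abs_signedSqrt_sq b] at h4
  rw [abs_rpow_three_halves b]
  nlinarith

/-- Uniform convexity of `|a| ^ (3 / 2)`. -/
theorem abs_sub_rpow_le (a b : ℝ) {k : ℝ} (hk : 0 < k) : |a - b| ^ (3 / 2 : ℝ) ≤
    12 / k * ((|a| ^ (3 / 2 : ℝ) + |b| ^ (3 / 2 : ℝ)) / 2 - |(a + b) / 2| ^ (3 / 2 : ℝ)) +
      k ^ 3 * (|a| ^ (3 / 2 : ℝ) + |b| ^ (3 / 2 : ℝ)) := by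
  set m := (a + b) / 2
  set q := |signedSqrt a| + |signedSqrt b|
  set G := (|a| ^ (3 / 2 : ℝ) + |b| ^ (3 / 2 : ℝ)) / 2 - |m| ^ (3 / 2 : ℝ)
  have hq0 : 0 ≤ q := by positivity
  have hm : |signedSqrt m| ≤ q := by
    refine abs_le_of_sq_le_sq' ?_ hq0 |> fun h => abs_le.2 h
    rw [← sq_abs, abs_signedSqrt_sq]
    have h1 : |m| ≤ (|a| + |b|) / 2 := by
      rw [abs_div, abs_two]; gcongr; exact abs_add_le a b
    rw [← abs_signedSqrt_sq a, ← abs_signedSqrt_sq b] at h1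
    nlinarith [abs_nonneg (signedSqrt a), abs_nonneg (signedSqrt b),
      mul_nonneg (abs_nonneg (signedSqrt a)) (abs_nonneg (signedSqrt b))]
  -- Sum of the tangent inequalities at the midpoint, applied to `a` and to `b`: the linear terms
  -- cancel.
  have hG : (a - b) ^ 2 ≤ 16 * q * G := by
    have hA := sq_sub_le_tangent m a
    have hB := sq_sub_le_tangent m b
    have hTa := sub_nonneg.2 (tangent_le m a)
    have hTb := sub_nonneg.2 (tangent_le m b)
    have h1 : |signedSqrt m| + |signedSqrt a| ≤ 2 * q := by
      have := abs_nonneg (signedSqrt b); simp only [q] at hm ⊢; linarith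
    have h2 : |signedSqrt m| + |signedSqrt b| ≤ 2 * q := by
      have := abs_nonneg (signedSqrt a); simp only [q] at hm ⊢; linarith
    have hA' := mul_le_mul_of_nonneg_right h1 hTa
    have hB' := mul_le_mul_of_nonneg_right h2 hTb
    have e1 : a - m = (a - b) / 2 := by simp only [m]; ring
    have e2 : b - m = -((a - b) / 2) := by simp only [m]; ring
    rw [e1] at hA hA'
    rw [e2] at hB hB'
    simp only [G]
    nlinarith
  rcases hq0.eq_or_lt with h0 | hpos
  · rw [← h0] at hG
    have hab : a - b = 0 := by nlinarith
    have ha : |signedSqrt a| = 0 := by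
      linarith [abs_nonneg (signedSqrt a), abs_nonneg (signedSqrt b), h0]
    have hb : |signedSqrt b| = 0 := by
      linarith [abs_nonneg (signedSqrt a), abs_nonneg (signedSqrt b), h0]
    have hm0 : |signedSqrt m| = 0 := le_antisymm (h0 ▸ hm) (abs_nonneg _)
    simp only [G, abs_rpow_three_halves, ha, hb, hm0]
    rw [hab]
    simp [signedSqrt]
  · set d := |signedSqrt (a - b)|
    have hd0 : 0 ≤ d := abs_nonneg _
    have hd : d ^ 4 ≤ 16 * q * G := by
      have : d ^ 4 = (a - b) ^ 2 := by
        rw [← sq_abs (a - b), ← abs_signedSqrt_sq]; ring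
      rwa [this]
    have hq3 : q ^ 3 ≤ 4 * (|a| ^ (3 / 2 : ℝ) + |b| ^ (3 / 2 : ℝ)) := by
      rw [abs_rpow_three_halves, abs_rpow_three_halves]
      have h1 := abs_nonneg (signedSqrt a)
      have h2 := abs_nonneg (signedSqrt b)
      have := mul_nonneg (add_nonneg h1 h2) (sq_nonneg (|signedSqrt a| - |signedSqrt b|))
      simp only [q]
      nlinarith
    -- Young's inequality with a free parameter `k`. It keeps the final bound linear in `G` and in
    -- the powers, so that it can be integrated directly; `k` is chosen only afterwards.
    have hyoung : 4 * d ^ 3 * (k * q) ≤ 3 * d ^ 4 + (k * q) ^ 4 := by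
      have : 0 ≤ (d - k * q) ^ 2 * (3 * d ^ 2 + 2 * d * (k * q) + (k * q) ^ 2) := by positivity
      nlinarith
    rw [abs_rpow_three_halves]
    have hkq : 0 < 4 * (k * q) := by positivity
    have h1 : d ^ 3 * (4 * (k * q)) ≤ (12 / k * G + k ^ 3 * (q ^ 3 / 4)) * (4 * (k * q)) := by
      have : (12 / k * G + k ^ 3 * (q ^ 3 / 4)) * (4 * (k * q)) = 3 * (16 * q * G) + (k * q) ^ 4 := by
        field_simp
        ring
      rw [this]
      linarith
    have h2 := le_of_mul_le_mul_right h1 hkq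
    refine h2.trans ?_
    gcongr
    linarith

/-! ### The duality pairing and the energy -/

/-- Two decompositions differ by `W = V₁ - W₁ = W₂ - V₂`, which lies in both the Sobolev space and
`L³`, where the two pairings agree by `HasRep.inner_eq_integral`. -/
theorem dualPairing_eq {V V₁ V₂ ρ : Plane → ℝ} {f : GagL2} (h : HasRep ρ f)
    (hρ : MemLp ρ (3 / 2)) (hd : IsDecomposition V V₁ V₂) :
    dualPairing ρ V = inner ℝ f hd.1.hasDiff.memLp.toLp + ∫ x, ρ x * V₂ x := by
  have hV : MemDual V := ⟨V₁, V₂, hd⟩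
  rw [dualPairing, dif_pos hV]
  set W₁ := hV.choose
  set W₂ := hV.choose_spec.choose
  have hd' : IsDecomposition V W₁ W₂ := hV.choose_spec.choose_spec
  have hW := hd.1.sub hd'.1
  have hae : (fun x => V₁ x - W₁ x) =ᵐ[volume] fun x => W₂ x - V₂ x := by
    filter_upwards [hd.2.2, hd'.2.2] with x h1 h2
    linarith
  have hW3 : MemLp (fun x => V₁ x - W₁ x) 3 := (memLp_congr_ae hae).2 (hd'.2.1.sub hd.2.1)
  have h1 := h.inner_eq_integral hρ hW hW3
  have h2 : hW.hasDiff.memLp.toLp = hd.1.hasDiff.memLp.toLp - hd'.1.hasDiff.memLp.toLp := by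
    rw [← MemLp.toLp_sub]
    congr 1
    ext z
    simp only [diff, Pi.sub_apply]
    ring
  have h3 : ∫ x, ρ x * (V₁ x - W₁ x) = (∫ x, ρ x * W₂ x) - ∫ x, ρ x * V₂ x := by
    rw [← integral_sub (integrable_mul_of_memLp hρ hd'.2.1) (integrable_mul_of_memLp hρ hd.2.1)]
    refine integral_congr_ae ?_
    filter_upwards [hae] with x hx
    rw [hx, mul_sub]
  rw [h2, inner_sub_right, h3] at h1
  rw [h.hPair_eq hd'.1]
  linarith

theorem MemH0.exists_rep {ρ : Plane → ℝ} (h : MemH0 ρ) : ∃ f, HasRep ρ f := h.1.exists_rep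

theorem HasRep.memH0 {ρ : Plane → ℝ} {f : GagL2} (h : HasRep ρ f) (hρ : MemLp ρ (3 / 2)) :
    MemH0 ρ := ⟨h.memHNegHalf, hρ⟩

theorem hasRep_zero : HasRep (fun _ => 0) 0 where
  locallyIntegrable := locallyIntegrable_zero
  mem := zero_mem _
  integral_eq φ := by simp

/-- The kinetic integral `∫ |ρ| ^ (3 / 2)`. -/
def tfInt (ρ : Plane → ℝ) : ℝ := ∫ x, |ρ x| ^ (3 / 2 : ℝ)

theorem tfInt_nonneg (ρ : Plane → ℝ) : 0 ≤ tfInt ρ :=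
  integral_nonneg fun x => by positivity

theorem toReal_three_halves : (3 / 2 : ℝ≥0∞).toReal = 3 / 2 := by simp

theorem three_halves_ne_top : (3 / 2 : ℝ≥0∞) ≠ ∞ := by
  exact ENNReal.div_ne_top (by simp) (by simp)

theorem one_le_three_halves : (1 : ℝ≥0∞) ≤ 3 / 2 := by
  rw [ENNReal.le_div_iff_mul_le (by simp) (by simp)]
  norm_num

instance : Fact ((1 : ℝ≥0∞) ≤ 3 / 2) := ⟨one_le_three_halves⟩

theorem integrable_tf {ρ : Plane → ℝ} (hρ : MemLp ρ (3 / 2)) :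
    Integrable fun x => |ρ x| ^ (3 / 2 : ℝ) := by
  have := hρ.integrable_norm_rpow (by simp) three_halves_ne_top
  rwa [toReal_three_halves] at this

theorem norm_toLp_rpow {ρ : Plane → ℝ} (hρ : MemLp ρ (3 / 2)) :
    ‖hρ.toLp‖ ^ (3 / 2 : ℝ) = tfInt ρ := by
  have h0 := tfInt_nonneg ρ
  rw [Lp.norm_toLp, hρ.eLpNorm_eq_integral_rpow_norm (by simp) three_halves_ne_top,
    toReal_three_halves, ENNReal.toReal_ofReal (by positivity), ← Real.rpow_mul]
  · norm_num [tfInt]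
  · exact h0

section Energy

variable {V V₁ V₂ ρ σ : Plane → ℝ} {f g : GagL2}

theorem energy_eq (h : HasRep ρ f) (hρ : MemLp ρ (3 / 2)) (hd : IsDecomposition V V₁ V₂) :
    energy V ρ = 2 / 3 * tfInt ρ - (inner ℝ f hd.1.hasDiff.memLp.toLp + ∫ x, ρ x * V₂ x) +
      1 / 2 * ‖f‖ ^ 2 := by
  rw [energy, dualPairing_eq h hρ hd, h.hNegHalfNorm_eq, tfInt]

/-- The energy controls the kinetic integral. -/
theorem exists_coercive (hV : MemDual V) :
    ∃ c : ℝ, ∀ ρ, MemH0 ρ → 1 / 3 * tfInt ρ - c ≤ energy V ρ := by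
  obtain ⟨V₁, V₂, hd⟩ := hV
  set F := hd.1.hasDiff.memLp.toLp
  set B := (eLpNorm V₂ 3 volume).toReal
  refine ⟨4 / 3 * B ^ 3 + 1 / 2 * ‖F‖ ^ 2, fun ρ hρ => ?_⟩
  obtain ⟨f, hf⟩ := hρ.exists_rep
  rw [energy_eq hf hρ.2 hd]
  have h1 : inner ℝ f F ≤ 1 / 2 * ‖f‖ ^ 2 + 1 / 2 * ‖F‖ ^ 2 := by
    have := real_inner_le_norm f F
    nlinarith [sq_nonneg (‖f‖ - ‖F‖)]
  have h2 : ∫ x, ρ x * V₂ x ≤ 1 / 3 * tfInt ρ + 4 / 3 * B ^ 3 := by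
    refine (le_abs_self _).trans ((abs_integral_mul_le hρ.2 hd.2.1).trans ?_)
    rw [← norm_toLp_rpow hρ.2, ← Lp.norm_toLp _ hρ.2]
    set x := Real.sqrt ‖hρ.2.toLp‖
    have hx : ‖hρ.2.toLp‖ = x ^ 2 := (Real.sq_sqrt (norm_nonneg _)).symm
    have hx0 : 0 ≤ x := Real.sqrt_nonneg _
    have hx3 : ‖hρ.2.toLp‖ ^ (3 / 2 : ℝ) = x ^ 3 := by
      rw [hx, ← Real.rpow_natCast x 2, ← Real.rpow_mul hx0, ← Real.rpow_natCast x 3]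
      norm_num
    rw [hx3, hx]
    have hB : 0 ≤ B := ENNReal.toReal_nonneg
    -- The expansion `(x - 2 B) ^ 2 (x + B) = x ^ 3 - 3 x ^ 2 B + 4 B ^ 3` is the required Young
    -- inequality.
    have := mul_nonneg (sq_nonneg (x - 2 * B)) (add_nonneg hx0 hB)
    nlinarith
  linarith

/-- Uniform convexity of the energy. -/
theorem energy_gap (hV : MemDual V) {m : ℝ} (hm : ∀ τ, MemH0 τ → m ≤ energy V τ)
    (h : HasRep ρ f) (hρ : MemLp ρ (3 / 2)) (h' : HasRep σ g) (hσ : MemLp σ (3 / 2)) :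
    ‖f - g‖ ^ 2 ≤ 8 * ((energy V ρ + energy V σ) / 2 - m) ∧
      ∀ k : ℝ, 0 < k → tfInt (fun x => ρ x - σ x) ≤
        18 / k * ((energy V ρ + energy V σ) / 2 - m) + k ^ 3 * (tfInt ρ + tfInt σ) := by
  obtain ⟨V₁, V₂, hd⟩ := hV
  -- The midpoint has energy at least `m`, and the linear term cancels. The average energy exceeds
  -- the midpoint energy by `2 / 3` of the convexity gap of `tfInt` plus `‖f - g‖ ^ 2 / 8`.
  have hmid := (h.add h').const_mul (1 / 2)
  have hmidLp : MemLp (fun x => 1 / 2 * (ρ x + σ x)) (3 / 2) := (hρ.add hσ).const_mul _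
  have hmE := hm _ (hmid.memH0 hmidLp)
  rw [energy_eq hmid hmidLp hd, norm_smul, real_inner_smul_left, inner_add_left] at hmE
  rw [energy_eq h hρ hd, energy_eq h' hσ hd]
  set F := hd.1.hasDiff.memLp.toLp
  have hpar := parallelogram_law_with_norm ℝ f g
  have hint : ∫ x, 1 / 2 * (ρ x + σ x) * V₂ x = 1 / 2 * ((∫ x, ρ x * V₂ x) + ∫ x, σ x * V₂ x) := by
    rw [← integral_add (integrable_mul_of_memLp hρ hd.2.1) (integrable_mul_of_memLp hσ hd.2.1),
      ← integral_const_mul]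
    congr 1
    ext x
    ring
  have habs : ‖(1 / 2 : ℝ)‖ = 1 / 2 := by norm_num
  rw [hint, habs] at hmE
  have hk : ∀ k : ℝ, 0 < k → tfInt (fun x => ρ x - σ x) ≤ 12 / k *
      ((tfInt ρ + tfInt σ) / 2 - tfInt (fun x => 1 / 2 * (ρ x + σ x))) +
        k ^ 3 * (tfInt ρ + tfInt σ) := by
    intro k hk
    have i1 := integrable_tf hρ
    have i2 := integrable_tf hσ
    have i3 := integrable_tf hmidLp
    have i4 := ((i1.add i2).div_const 2).sub i3
    have i5 := (i4.const_mul (12 / k)).add ((i1.add i2).const_mul (k ^ 3))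
    have hle : tfInt (fun x => ρ x - σ x) ≤ ∫ x, (12 / k * ((|ρ x| ^ (3 / 2 : ℝ) +
        |σ x| ^ (3 / 2 : ℝ)) / 2 - |1 / 2 * (ρ x + σ x)| ^ (3 / 2 : ℝ)) +
          k ^ 3 * (|ρ x| ^ (3 / 2 : ℝ) + |σ x| ^ (3 / 2 : ℝ))) := by
      refine integral_mono (integrable_tf (hρ.sub hσ)) i5 fun x => ?_
      have := abs_sub_rpow_le (ρ x) (σ x) hk
      rwa [div_eq_inv_mul (ρ x + σ x), ← one_div] at this
    refine hle.trans (le_of_eq ?_)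
    have e1 := integral_add (i4.const_mul (12 / k)) ((i1.add i2).const_mul (k ^ 3))
    have e2 := integral_sub ((i1.add i2).div_const 2) i3
    have e3 := integral_add i1 i2
    simp only [Pi.add_apply, Pi.sub_apply] at e1 e2 e3
    rw [e1, integral_const_mul, integral_const_mul, e2, integral_div, e3]
    rfl
  -- Convexity of `tfInt` is recovered from `hk`, multiplied by `k`, as `k → 0`.
  have hG : 0 ≤ (tfInt ρ + tfInt σ) / 2 - tfInt (fun x => 1 / 2 * (ρ x + σ x)) := by
    have h1 : ∀ k : ℝ, 0 < k → 0 ≤ 12 *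
        ((tfInt ρ + tfInt σ) / 2 - tfInt (fun x => 1 / 2 * (ρ x + σ x))) +
          k ^ 4 * (tfInt ρ + tfInt σ) := by
      intro k hk0
      have h2 := (tfInt_nonneg _).trans (hk k hk0)
      have h3 := mul_nonneg hk0.le h2
      refine h3.trans (le_of_eq ?_)
      field_simp
    have h2 : Tendsto (fun k : ℝ => 12 *
        ((tfInt ρ + tfInt σ) / 2 - tfInt (fun x => 1 / 2 * (ρ x + σ x))) +
          k ^ 4 * (tfInt ρ + tfInt σ)) (𝓝[>] 0) (𝓝 (12 *
        ((tfInt ρ + tfInt σ) / 2 - tfInt (fun x => 1 / 2 * (ρ x + σ x))) +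
          0 ^ 4 * (tfInt ρ + tfInt σ))) := by
      refine Tendsto.mono_left (Continuous.tendsto ?_ 0) nhdsWithin_le_nhds
      fun_prop
    have h3 := ge_of_tendsto h2 (by filter_upwards [self_mem_nhdsWithin] with k hk0 using h1 k hk0)
    linarith
  set G := (tfInt ρ + tfInt σ) / 2 - tfInt (fun x => 1 / 2 * (ρ x + σ x)) with hGdef
  refine ⟨by nlinarith, fun k hk0 => (hk k hk0).trans ?_⟩
  have hfg := sq_nonneg ‖f - g‖
  have h1 : G ≤ 3 / 2 * ((2 / 3 * tfInt ρ - (inner ℝ f F + ∫ x, ρ x * V₂ x) + 1 / 2 * ‖f‖ ^ 2 +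
      (2 / 3 * tfInt σ - (inner ℝ g F + ∫ x, σ x * V₂ x) + 1 / 2 * ‖g‖ ^ 2)) / 2 - m) := by
    nlinarith
  have h2 : (0 : ℝ) ≤ 12 / k := by positivity
  have h3 := mul_le_mul_of_nonneg_left h1 h2
  have h4 : ∀ y : ℝ, 12 / k * (3 / 2 * y) = 18 / k * y := fun y => by ring
  rw [h4] at h3
  linarith

/-! ### Uniqueness and existence of the minimizer. -/

theorem ae_eq_of_tfInt_sub_eq_zero (hρ : MemLp ρ (3 / 2)) (hσ : MemLp σ (3 / 2))
    (h : tfInt (fun x => ρ x - σ x) = 0) : ρ =ᵐ[volume] σ := by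
  have h' := (integral_eq_zero_iff_of_nonneg (f := fun x => |ρ x - σ x| ^ (3 / 2 : ℝ))
    (fun x => by positivity) (integrable_tf (hρ.sub hσ))).1 h
  filter_upwards [h'] with x hx
  have := (Real.rpow_eq_zero (abs_nonneg _) (by norm_num)).1 hx
  exact sub_eq_zero.1 (abs_eq_zero.1 this)

/-- In `energy_gap` with `m` the minimal energy the gap is zero; only the term with `k ^ 3` remains,
and `k → 0`. -/
theorem IsMinimizer.ae_eq (hV : MemDual V) (h : IsMinimizer V ρ) (h' : IsMinimizer V σ) :
    ρ =ᵐ[volume] σ := by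
  obtain ⟨f, hf⟩ := h.1.exists_rep
  obtain ⟨g, hg⟩ := h'.1.exists_rep
  have heq : energy V ρ = energy V σ := le_antisymm (h.2 _ h'.1) (h'.2 _ h.1)
  have hgap := (energy_gap hV h.2 hf h.1.2 hg h'.1.2).2
  refine ae_eq_of_tfInt_sub_eq_zero h.1.2 h'.1.2 (le_antisymm ?_ (tfInt_nonneg _))
  have h2 : Tendsto (fun k : ℝ => k ^ 3 * (tfInt ρ + tfInt σ)) (𝓝[>] 0)
      (𝓝 (0 ^ 3 * (tfInt ρ + tfInt σ))) := by
    refine Tendsto.mono_left (Continuous.tendsto ?_ 0) nhdsWithin_le_nhds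
    fun_prop
  rw [zero_pow three_ne_zero, zero_mul] at h2
  refine ge_of_tendsto h2 ?_
  filter_upwards [self_mem_nhdsWithin] with k hk
  have := hgap k hk
  rw [← heq] at this
  simpa using this

/-- By `energy_gap` the Riesz representatives and the densities of a minimizing sequence are Cauchy
in their respective norms. The energy is continuous along such a sequence. -/
theorem exists_isMinimizer (hV : MemDual V) : ∃ ρ, IsMinimizer V ρ := by
  obtain ⟨c, hc⟩ := exists_coercive hV
  set S : Set ℝ := energy V '' {ρ | MemH0 ρ}
  have hne : S.Nonempty := ⟨_, _, hasRep_zero.memH0 (MemLp.zero' (p := 3 / 2)), rfl⟩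
  have hbdd : BddBelow S := by
    refine ⟨-c, ?_⟩
    rintro _ ⟨ρ, hρ, rfl⟩
    linarith [hc ρ hρ, tfInt_nonneg ρ]
  obtain ⟨u, hanti, hlim, hmem⟩ := exists_seq_tendsto_sInf hne hbdd
  set m := sInf S
  have hm : ∀ τ, MemH0 τ → m ≤ energy V τ := fun τ hτ => csInf_le hbdd ⟨τ, hτ, rfl⟩
  choose ρ hρ hρu using hmem
  choose f hf using fun n => (hρ n).exists_rep
  have hgap := fun n k => energy_gap hV hm (hf n) (hρ n).2 (hf k) (hρ k).2
  have hΔ : ∀ N n k, N ≤ n → N ≤ k → (energy V (ρ n) + energy V (ρ k)) / 2 - m ≤ u N - m := by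
    intro N n k hn hk
    rw [hρu, hρu]
    linarith [hanti hn, hanti hk]
  have hδ : Tendsto (fun N => u N - m) atTop (𝓝 0) := by
    simpa using hlim.sub_const m
  have hcf : CauchySeq f := by
    refine cauchySeq_of_le_tendsto_0 (fun N => Real.sqrt (8 * (u N - m))) (fun n k N hn hk => ?_) ?_
    · rw [dist_eq_norm]
      refine Real.le_sqrt_of_sq_le ((hgap n k).1.trans ?_)
      linarith [hΔ N n k hn hk]
    · have := (Real.continuous_sqrt.tendsto _).comp (hδ.const_mul 8)
      simpa only [mul_zero, Real.sqrt_zero] using! this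
  -- Coercivity and monotonicity of `u` bound all kinetic integrals by this constant.
  set B := 3 * (u 0 + c)
  have hB : ∀ n, tfInt (ρ n) ≤ B := fun n => by
    have h1 := hc _ (hρ n)
    rw [hρu] at h1
    linarith [hanti (Nat.zero_le n)]
  have hB0 : 0 ≤ B := (tfInt_nonneg _).trans (hB 0)
  set R : ℕ → Lp ℝ (3 / 2) (volume : Measure Plane) := fun n => (hρ n).2.toLp
  have hcR : CauchySeq R := by
    rw [Metric.cauchySeq_iff]
    intro ε hε
    set η := ε ^ (3 / 2 : ℝ)
    have hη : 0 < η := by positivity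
    -- First `k` makes the term with `k ^ 3` small, uniformly by `B`; then `N` makes the energy gap
    -- small compared with `k`.
    obtain ⟨k, hk0, hk⟩ : ∃ k : ℝ, 0 < k ∧ k ^ 3 * (B + B) < η / 2 := by
      have h2 : Tendsto (fun k : ℝ => k ^ 3 * (B + B)) (𝓝[>] 0) (𝓝 (0 ^ 3 * (B + B))) := by
        refine Tendsto.mono_left (Continuous.tendsto ?_ 0) nhdsWithin_le_nhds
        fun_prop
      rw [zero_pow three_ne_zero, zero_mul] at h2
      exact ((eventually_mem_nhdsWithin (a := (0 : ℝ)) (s := Set.Ioi 0)).and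
        (h2.eventually (gt_mem_nhds (half_pos hη)))).exists
    have h3 : Tendsto (fun N => 18 / k * (u N - m)) atTop (𝓝 0) := by
      simpa using hδ.const_mul (18 / k)
    obtain ⟨N, hN⟩ := (h3.eventually (gt_mem_nhds (half_pos hη))).exists
    refine ⟨N, fun n hn l hl => ?_⟩
    have h4 := (hgap n l).2 k hk0
    have h5 : 18 / k * ((energy V (ρ n) + energy V (ρ l)) / 2 - m) ≤ 18 / k * (u N - m) :=
      mul_le_mul_of_nonneg_left (hΔ N n l hn hl) (by positivity)
    have h6 : k ^ 3 * (tfInt (ρ n) + tfInt (ρ l)) ≤ k ^ 3 * (B + B) := by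
      gcongr <;> exact hB _
    have h7 : tfInt (fun x => ρ n x - ρ l x) < η := by linarith
    rw [dist_eq_norm, ← MemLp.toLp_sub]
    refine (Real.rpow_lt_rpow_iff (norm_nonneg _) hε.le (by norm_num : (0 : ℝ) < 3 / 2)).1 ?_
    rw [norm_toLp_rpow]
    exact h7
  obtain ⟨f', hf'⟩ := cauchySeq_tendsto_of_complete hcf
  obtain ⟨R', hR'⟩ := cauchySeq_tendsto_of_complete hcR
  have hR'p : MemLp R' (3 / 2) := Lp.memLp R'
  have hconv : Tendsto (fun n => eLpNorm (ρ n - ⇑R') (3 / 2) volume) atTop (𝓝 0) := by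
    rw [Lp.tendsto_Lp_iff_tendsto_eLpNorm'] at hR'
    refine hR'.congr fun n => eLpNorm_congr_ae ?_
    exact (hρ n).2.coeFn_toLp.sub (EventuallyEq.refl _ _)
  have hpair : ∀ v : Plane → ℝ, MemLp v 3 →
      Tendsto (fun n => ∫ x, ρ n x * v x) atTop (𝓝 (∫ x, R' x * v x)) := fun v hv =>
    tendsto_integral_mul (p := 3 / 2) (q := 3) (fun n => (hρ n).2) (fun _ => hv) hR'p hv hconv
      (by simp)
  -- The two limits belong to the same distribution, since pairings with a test function converge in
  -- both senses.
  have hrep : HasRep R' f' := by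
    refine ⟨hR'p.locallyIntegrable one_le_three_halves, ?_, fun φ => ?_⟩
    · exact (Submodule.isClosed_topologicalClosure _).mem_of_tendsto hf'
        (Eventually.of_forall fun n => (hf n).mem)
    · refine tendsto_nhds_unique (hpair φ (φ.memLp 3)) ?_
      simp only [(hf _).integral_eq]
      exact hf'.inner tendsto_const_nhds
  have hE : Tendsto (fun n => energy V (ρ n)) atTop (𝓝 (energy V R')) := by
    obtain ⟨V₁, V₂, hd⟩ := hV
    rw [energy_eq hrep hR'p hd]
    simp only [energy_eq (hf _) (hρ _).2 hd]
    have h1 : Tendsto (fun n => tfInt (ρ n)) atTop (𝓝 (tfInt R')) := by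
      have h2 := hR'.norm.rpow_const (p := 3 / 2) (Or.inr (by norm_num))
      simp only [R, norm_toLp_rpow] at h2
      have h3 : ‖R'‖ ^ (3 / 2 : ℝ) = tfInt R' := by
        rw [← norm_toLp_rpow hR'p, Lp.toLp_coeFn]
      rwa [h3] at h2
    exact ((h1.const_mul _).sub ((hf'.inner tendsto_const_nhds).add (hpair V₂ hd.2.1))).add
      ((hf'.norm.pow 2).const_mul _)
  have hEm : energy V R' = m := by
    refine tendsto_nhds_unique hE ?_
    simpa only [hρu] using hlim
  exact ⟨R', hrep.memH0 hR'p, fun σ hσ => hEm ▸ hm σ hσ⟩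

/-! ### The Euler–Lagrange equation -/

theorem memLp_signedSqrt (hρ : MemLp ρ (3 / 2)) : MemLp (fun x => signedSqrt (ρ x)) 3 := by
  have hm : AEStronglyMeasurable (fun x => signedSqrt (ρ x)) volume :=
    (measurable_signedSqrt.comp_aemeasurable hρ.1.aemeasurable).aestronglyMeasurable
  rw [← integrable_norm_rpow_iff hm (by simp) (by simp)]
  refine (integrable_tf hρ).congr (Eventually.of_forall fun x => ?_)
  simp only [abs_rpow_three_halves, Real.norm_eq_abs]
  norm_num

theorem integrable_signedSqrt_mul (hρ : MemLp ρ (3 / 2)) (hσ : MemLp σ (3 / 2)) :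
    Integrable fun x => signedSqrt (ρ x) * σ x := by
  simpa only [mul_comm] using integrable_mul_of_memLp hσ (memLp_signedSqrt hρ)

theorem IsMinimizer.variation_nonneg (h : IsMinimizer V ρ) (hd : IsDecomposition V V₁ V₂)
    (hf : HasRep ρ f) (hg : HasRep σ g) (hσ : MemLp σ (3 / 2)) :
    0 ≤ (∫ x, signedSqrt (ρ x) * σ x) -
      (inner ℝ g hd.1.hasDiff.memLp.toLp + ∫ x, σ x * V₂ x) + inner ℝ f g := by
  set F := hd.1.hasDiff.memLp.toLp
  set L := (∫ x, signedSqrt (ρ x) * σ x) - (inner ℝ g F + ∫ x, σ x * V₂ x) + inner ℝ f g with hL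
  have hρ := h.1.2
  -- The perturbation is `s ^ 2 σ`, so that its power `3 / 2` produces the integer power `s ^ 3`;
  -- dividing by `s ^ 2` leaves errors of order `s` and `s ^ 2`.
  have key : ∀ s : ℝ, 0 < s → 0 ≤ L + 2 * s * tfInt σ + s ^ 2 * ‖g‖ ^ 2 / 2 := by
    intro s hs
    have hrep := hf.add (hg.const_mul (s ^ 2))
    have hLp : MemLp (fun x => ρ x + s ^ 2 * σ x) (3 / 2) := hρ.add (hσ.const_mul _)
    have hmin := h.2 _ (hrep.memH0 hLp)
    rw [energy_eq hf hρ hd, energy_eq hrep hLp hd, inner_add_left, real_inner_smul_left,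
      norm_add_sq_real, real_inner_smul_right, norm_smul] at hmin
    have hint : ∫ x, (ρ x + s ^ 2 * σ x) * V₂ x = (∫ x, ρ x * V₂ x) + s ^ 2 * ∫ x, σ x * V₂ x := by
      rw [← integral_const_mul, ← integral_add (integrable_mul_of_memLp hρ hd.2.1)
        ((integrable_mul_of_memLp hσ hd.2.1).const_mul _)]
      congr 1
      ext x
      ring
    have htf : tfInt (fun x => ρ x + s ^ 2 * σ x) ≤
        tfInt ρ + 3 / 2 * s ^ 2 * (∫ x, signedSqrt (ρ x) * σ x) + 3 * s ^ 3 * tfInt σ := by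
      have i1 := integrable_tf hρ
      have i2 := (integrable_signedSqrt_mul hρ hσ).const_mul (3 / 2 * s ^ 2)
      have i3 := (integrable_tf hσ).const_mul (3 * s ^ 3)
      have hle : tfInt (fun x => ρ x + s ^ 2 * σ x) ≤ ∫ x, (|ρ x| ^ (3 / 2 : ℝ) +
          3 / 2 * s ^ 2 * (signedSqrt (ρ x) * σ x) + 3 * s ^ 3 * |σ x| ^ (3 / 2 : ℝ)) := by
        refine integral_mono (integrable_tf hLp) ((i1.add i2).add i3) fun x => ?_
        refine (abs_add_rpow_le _ _).trans (le_of_eq ?_)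
        have hs3 : |s ^ 2 * σ x| ^ (3 / 2 : ℝ) = s ^ 3 * |σ x| ^ (3 / 2 : ℝ) := by
          rw [abs_mul, Real.mul_rpow (abs_nonneg _) (abs_nonneg _), abs_of_nonneg (sq_nonneg s),
            ← Real.rpow_natCast s 2, ← Real.rpow_mul hs.le, ← Real.rpow_natCast s 3]
          norm_num
        rw [hs3]
        ring
      refine hle.trans (le_of_eq ?_)
      have hadd := integral_add (i1.add i2) i3
      simp only [Pi.add_apply] at hadd
      rw [hadd, integral_add i1 i2, integral_const_mul, integral_const_mul]
      rfl
    have habs : ‖s ^ 2‖ = s ^ 2 := by rw [Real.norm_eq_abs, abs_of_nonneg (sq_nonneg s)]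
    rw [hint, habs] at hmin
    have hfin : 0 ≤ s ^ 2 * (L + 2 * s * tfInt σ + s ^ 2 * ‖g‖ ^ 2 / 2) := by
      rw [hL]
      nlinarith
    exact nonneg_of_mul_nonneg_right hfin (by positivity)
  have hlim : Tendsto (fun s : ℝ => L + 2 * s * tfInt σ + s ^ 2 * ‖g‖ ^ 2 / 2) (𝓝[>] 0)
      (𝓝 (L + 2 * 0 * tfInt σ + 0 ^ 2 * ‖g‖ ^ 2 / 2)) := by
    refine Tendsto.mono_left (Continuous.tendsto ?_ 0) nhdsWithin_le_nhds
    fun_prop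
  have := ge_of_tendsto hlim (by filter_upwards [self_mem_nhdsWithin] with s hs using key s hs)
  simpa using this

/-- The one-sided inequality applied to `σ` and to `-σ`. -/
theorem IsMinimizer.variation_eq_zero (h : IsMinimizer V ρ) (hd : IsDecomposition V V₁ V₂)
    (hf : HasRep ρ f) (hg : HasRep σ g) (hσ : MemLp σ (3 / 2)) :
    (∫ x, signedSqrt (ρ x) * σ x) -
      (inner ℝ g hd.1.hasDiff.memLp.toLp + ∫ x, σ x * V₂ x) + inner ℝ f g = 0 := by
  have h1 := h.variation_nonneg hd hf hg hσ
  have h2 := h.variation_nonneg hd hf (hg.const_mul (-1)) (hσ.const_mul (-1))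
  have h3 : ∫ x, signedSqrt (ρ x) * (-1 * σ x) = - ∫ x, signedSqrt (ρ x) * σ x := by
    rw [← integral_neg]; congr 1; ext x; ring
  have h4 : ∫ x, -1 * σ x * V₂ x = - ∫ x, σ x * V₂ x := by
    rw [← integral_neg]; congr 1; ext x; ring
  rw [h3, h4, real_inner_smul_left, real_inner_smul_right] at h2
  linarith

theorem IsMinimizer.eulerLagrange (hV : MemDual V) (h : IsMinimizer V ρ) : EulerLagrange V ρ := by
  obtain ⟨V₁, V₂, hd⟩ := hV
  obtain ⟨f, hf⟩ := h.1.exists_rep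
  intro φ hφ
  obtain ⟨g, hg⟩ := hφ.exists_rep
  rw [dualPairing_eq hg hφ.2 hd, hf.hNegHalfInner_eq hg]
  exact h.variation_eq_zero hd hf hg hφ.2

end Energy

/-! ### The half-Laplacian -/

/-- The symmetric second difference. -/
def secondDiff (φ : Plane → ℝ) (x h : Plane) : ℝ := 2 * φ x - φ (x + h) - φ (x - h)

theorem halfLaplacian_eq (φ : Plane → ℝ) (x : Plane) :
    halfLaplacian φ x = ∫ h, secondDiff φ x h ∂incMeas := by
  rw [incMeas, integral_withDensity_eq_integral_toReal_smul (by fun_prop) (by simp),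
    halfLaplacian, ← integral_const_mul]
  congr 1
  ext h
  rw [ENNReal.toReal_ofReal (rieszKernel_nonneg h), rieszKernel, smul_eq_mul, secondDiff]
  ring

theorem Test.exists_secondDiff_le (φ : Test) :
    ∃ B : ℝ, 0 ≤ B ∧ ∀ x h, |secondDiff φ x h| ≤ B * min 1 (‖h‖ ^ 2) := by
  obtain ⟨M, hM0, hM⟩ := φ.exists_bound
  have hd : ∀ x, DifferentiableAt ℝ φ x := fun x => (φ.contDiff.differentiable (by simp)) x
  have hcd : ContDiff ℝ 1 (fderiv ℝ φ) := φ.contDiff.fderiv_right (by norm_cast)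
  obtain ⟨C, hC⟩ := ContDiff.lipschitzWith_of_hasCompactSupport
    (φ.hasCompactSupport.fderiv ℝ) hcd one_ne_zero
  have hquad : ∀ x h, |secondDiff φ x h| ≤ C * ‖h‖ ^ 2 := by
    intro x h
    -- A second difference is an increment of the first difference `φ (y + h) - φ y`, whose
    -- derivative is `O(‖h‖)` because that of `φ` is Lipschitz.
    have hg : ∀ y, HasFDerivAt (fun y => φ (y + h) - φ y) (fderiv ℝ φ (y + h) - fderiv ℝ φ y) y :=
      fun y => ((hasFDerivAt_comp_add_right h).2 (hd (y + h)).hasFDerivAt).sub (hd y).hasFDerivAt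
    have hb : ∀ y, ‖fderiv ℝ φ (y + h) - fderiv ℝ φ y‖ ≤ C * ‖h‖ := fun y => by
      have := hC.dist_le_mul (y + h) y
      rwa [dist_eq_norm, dist_eq_norm, add_sub_cancel_left] at this
    have := convex_univ.norm_image_sub_le_of_norm_hasFDerivWithin_le
      (fun y _ => (hg y).hasFDerivWithinAt) (fun y _ => hb y) (Set.mem_univ x)
      (Set.mem_univ (x - h))
    rw [sub_add_cancel, sub_sub_cancel_left, norm_neg, Real.norm_eq_abs] at this
    have heq : secondDiff φ x h = φ x - φ (x - h) - (φ (x + h) - φ x) := by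
      rw [secondDiff]; ring
    rw [heq]
    linarith
  refine ⟨max (4 * M) C, by positivity, fun x h => ?_⟩
  rw [mul_min_of_nonneg _ _ (by positivity), mul_one]
  refine le_min (le_trans ?_ (le_max_left _ _)) ((hquad x h).trans ?_)
  · have h1 := abs_le.1 (hM x)
    have h2 := abs_le.1 (hM (x + h))
    have h3 := abs_le.1 (hM (x - h))
    rw [secondDiff, abs_le]
    constructor <;> linarith [h1.1, h1.2, h2.1, h2.2, h3.1, h3.2]
  · gcongr
    exact le_max_right _ _

theorem Test.continuous_secondDiff (φ : Test) :
    Continuous fun z : Plane × Plane => secondDiff φ z.2 z.1 := by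
  have := φ.continuous
  unfold secondDiff
  fun_prop

theorem Test.exists_enorm_secondDiff_le (φ : Test) : ∃ B : ℝ≥0∞, B ≠ ∞ ∧
    ∀ x h, ‖secondDiff φ x h‖ₑ ≤ B * ENNReal.ofReal (min 1 (‖h‖ ^ 2)) := by
  obtain ⟨B, hB0, hB⟩ := φ.exists_secondDiff_le
  refine ⟨ENNReal.ofReal B, ENNReal.ofReal_ne_top, fun x h => ?_⟩
  rw [← ENNReal.ofReal_mul hB0, Real.enorm_eq_ofReal_abs]
  exact ENNReal.ofReal_le_ofReal (hB x h)

theorem Test.exists_lintegral_secondDiff_le (φ : Test) :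
    ∃ C : ℝ≥0∞, C ≠ ∞ ∧ ∀ x, ∫⁻ h, ‖secondDiff φ x h‖ₑ ∂incMeas ≤ C := by
  obtain ⟨B, hB, h⟩ := φ.exists_enorm_secondDiff_le
  have := lintegral_min_sq_lt_top
  refine ⟨B * ∫⁻ h : Plane, ENNReal.ofReal (min 1 (‖h‖ ^ 2)) ∂incMeas, by finiteness, fun x => ?_⟩
  rw [← lintegral_const_mul' _ _ hB]
  exact lintegral_mono (h x)

theorem Test.lintegral_lintegral_secondDiff_lt_top (φ : Test) :
    ∫⁻ h, ∫⁻ x, ‖secondDiff φ x h‖ₑ ∂volume ∂incMeas < ∞ := by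
  obtain ⟨B, hB, hle⟩ := φ.exists_enorm_secondDiff_le
  have hK : volume (tsupport φ) ≠ ∞ := φ.hasCompactSupport.isCompact.measure_lt_top.ne
  calc ∫⁻ h, ∫⁻ x, ‖secondDiff φ x h‖ₑ ∂volume ∂incMeas
      ≤ ∫⁻ h, 3 * volume (tsupport φ) * (B * ENNReal.ofReal (min 1 (‖h‖ ^ 2))) ∂incMeas := by
        refine lintegral_mono fun h => ?_
        refine lintegral_le_of_translates (isClosed_tsupport _).measurableSet h (hle · h) ?_
        intro x h1 h2 h3
        simp [secondDiff, image_eq_zero_of_notMem_tsupport h1, image_eq_zero_of_notMem_tsupport h2,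
          image_eq_zero_of_notMem_tsupport h3]
    _ = 3 * volume (tsupport φ) * B * ∫⁻ h, ENNReal.ofReal (min 1 (‖h‖ ^ 2)) ∂incMeas := by
        rw [← lintegral_const_mul' _ _ (by finiteness)]
        simp only [mul_assoc]
    _ < ∞ := by
        have := lintegral_min_sq_lt_top
        finiteness

theorem Test.aemeasurable_secondDiff (φ : Test) :
    AEMeasurable (fun z : Plane × Plane => ‖secondDiff φ z.2 z.1‖ₑ) (incMeas.prod volume) :=
  φ.continuous_secondDiff.measurable.enorm.aemeasurable

theorem integrable_mul_secondDiff {u : Plane → ℝ} {p : ℝ≥0∞} (hu : MemLp u p) (hp : 1 ≤ p)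
    (hp' : p ≠ ∞) (φ : Test) :
    Integrable (fun z : Plane × Plane => u z.2 * secondDiff φ z.2 z.1) (incMeas.prod volume) := by
  have hum : AEStronglyMeasurable (fun z : Plane × Plane => u z.2) (incMeas.prod volume) :=
    hu.1.comp_quasiMeasurePreserving Measure.quasiMeasurePreserving_snd
  refine ⟨hum.mul φ.continuous_secondDiff.aestronglyMeasurable, ?_⟩
  have hp0 : p ≠ 0 := (zero_lt_one.trans_le hp).ne'
  have hq : 1 ≤ p.toReal := by
    rw [← ENNReal.toReal_one]; exact ENNReal.toReal_mono hp' hp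
  have hup : ∫⁻ x, ‖u x‖ₑ ^ p.toReal ≠ ∞ :=
    ((eLpNorm_lt_top_iff_lintegral_rpow_enorm_lt_top hp0 hp').1 hu.2).ne
  obtain ⟨C, hC, hCle⟩ := φ.exists_lintegral_secondDiff_le
  have hfin := φ.lintegral_lintegral_secondDiff_lt_top
  -- This splits the integral in two: the constant uses that the second difference is integrable in
  -- both variables, the power uses that its integral over `h` is bounded uniformly in `x`.
  have hpow : ∀ a : ℝ≥0∞, a ≤ 1 + a ^ p.toReal := fun a => by
    rcases le_total a 1 with h | h
    · exact h.trans le_self_add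
    · refine le_trans ?_ le_add_self
      simpa using ENNReal.rpow_le_rpow_of_exponent_le h hq
  rw [HasFiniteIntegral]
  calc ∫⁻ z : Plane × Plane, ‖u z.2 * secondDiff φ z.2 z.1‖ₑ ∂(incMeas.prod volume)
      ≤ ∫⁻ z : Plane × Plane, (‖secondDiff φ z.2 z.1‖ₑ +
          ‖u z.2‖ₑ ^ p.toReal * ‖secondDiff φ z.2 z.1‖ₑ) ∂(incMeas.prod volume) := by
        refine lintegral_mono fun z => ?_
        rw [enorm_mul, ← one_add_mul]
        gcongr
        exact hpow _
    _ = (∫⁻ h, ∫⁻ x, ‖secondDiff φ x h‖ₑ ∂volume ∂incMeas) +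
        ∫⁻ x, ∫⁻ h, ‖u x‖ₑ ^ p.toReal * ‖secondDiff φ x h‖ₑ ∂incMeas ∂volume := by
        rw [lintegral_add_left' φ.aemeasurable_secondDiff,
          lintegral_prod _ φ.aemeasurable_secondDiff]
        congr 1
        exact lintegral_prod_symm _ ((hum.enorm.pow_const _).mul φ.aemeasurable_secondDiff)
    _ ≤ (∫⁻ h, ∫⁻ x, ‖secondDiff φ x h‖ₑ ∂volume ∂incMeas) +
        ∫⁻ x, ‖u x‖ₑ ^ p.toReal * C := by
        gcongr with x
        rw [lintegral_const_mul _ (by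
          have := φ.continuous_secondDiff
          have h2 : Continuous fun h => secondDiff φ x h := this.comp (by fun_prop : Continuous
            fun h : Plane => (h, x))
          exact h2.measurable.enorm)]
        gcongr
        exact hCle x
    _ < ∞ := by
        rw [lintegral_mul_const' _ _ hC]
        finiteness

theorem integral_mul_halfLaplacian {u : Plane → ℝ} {p : ℝ≥0∞} (hu : MemLp u p) (hp : 1 ≤ p)
    (hp' : p ≠ ∞) (φ : Test) :
    ∫ x, u x * halfLaplacian φ x = ∫ h, ∫ x, u x * secondDiff φ x h ∂volume ∂incMeas := by
  rw [integral_integral_swap (integrable_mul_secondDiff hu hp hp' φ)]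
  simp only [integral_const_mul, halfLaplacian_eq]

/-- The half-Laplacian of a test function is bounded by `C` and integrable, hence `|·| ^ q ≤ C ^ (q
- 1) |·|` is integrable. -/
theorem Test.memLp_halfLaplacian (φ : Test) {q : ℝ≥0∞} (hq : 1 ≤ q) (hq' : q ≠ ∞) :
    MemLp (halfLaplacian φ) q := by
  have heq : halfLaplacian φ = fun x => ∫ h, secondDiff φ x h ∂incMeas := by
    ext x; exact halfLaplacian_eq φ x
  have hq0 : q ≠ 0 := (zero_lt_one.trans_le hq).ne'
  have hr : 1 ≤ q.toReal := by
    rw [← ENNReal.toReal_one]; exact ENNReal.toReal_mono hq' hq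
  rw [heq]
  refine ⟨?_, ?_⟩
  · have h1 : AEStronglyMeasurable (fun z : Plane × Plane => secondDiff φ z.1 z.2)
        (volume.prod incMeas) :=
      (φ.continuous_secondDiff.comp continuous_swap).aestronglyMeasurable
    exact h1.integral_prod_right'
  rw [eLpNorm_lt_top_iff_lintegral_rpow_enorm_lt_top hq0 hq']
  obtain ⟨C, hC, hCle⟩ := φ.exists_lintegral_secondDiff_le
  have hswap : ∫⁻ x, ∫⁻ h, ‖secondDiff φ x h‖ₑ ∂incMeas ∂volume < ∞ := by
    have := φ.lintegral_lintegral_secondDiff_lt_top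
    rwa [lintegral_lintegral_swap φ.aemeasurable_secondDiff] at this
  calc ∫⁻ x, ‖∫ h, secondDiff φ x h ∂incMeas‖ₑ ^ q.toReal
      ≤ ∫⁻ x, C ^ (q.toReal - 1) * ∫⁻ h, ‖secondDiff φ x h‖ₑ ∂incMeas := by
        refine lintegral_mono fun x => ?_
        set a := ∫⁻ h, ‖secondDiff φ x h‖ₑ ∂incMeas
        have h1 : ‖∫ h, secondDiff φ x h ∂incMeas‖ₑ ≤ a := enorm_integral_le_lintegral_enorm _
        refine (ENNReal.rpow_le_rpow h1 (by positivity)).trans ?_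
        have h2 : a ^ q.toReal = a ^ (q.toReal - 1) * a := by
          nth_rw 3 [← ENNReal.rpow_one a]
          rw [← ENNReal.rpow_add_of_nonneg _ _ (by linarith) zero_le_one, sub_add_cancel]
        rw [h2]
        gcongr
        exact hCle x
    _ < ∞ := by
        have h3 : C ^ (q.toReal - 1) ≠ ∞ := ENNReal.rpow_ne_top_of_nonneg (by linarith) hC
        rw [lintegral_const_mul' _ _ h3]
        finiteness

/-! ### Summation by parts -/

/-- Expand in the first factor and translate by `h` the term containing `a (x + h)`. -/
theorem integral_diff_mul_diff {p q : ℝ≥0∞} [ENNReal.HolderTriple p q 1] {a b : Plane → ℝ}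
    (ha : MemLp a p) (hb : MemLp b q) (h : Plane) :
    ∫ x, (a x - a (x + h)) * (b x - b (x + h)) = ∫ x, a x * secondDiff b x h := by
  have hb1 : MemLp (fun x => b (x + h)) q :=
    hb.comp_measurePreserving (measurePreserving_add_right volume h)
  have ha1 : MemLp (fun x => a (x + h)) p :=
    ha.comp_measurePreserving (measurePreserving_add_right volume h)
  have hb2 : MemLp (fun x => b (x - h)) q :=
    hb.comp_measurePreserving (measurePreserving_sub_right volume h)
  have hd : MemLp (fun x => b x - b (x + h)) q := hb.sub hb1
  have hd2 : MemLp (fun x => b (x - h) - b x) q := hb2.sub hb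
  have hshift : ∫ x, a (x + h) * (b x - b (x + h)) = ∫ x, a x * (b (x - h) - b x) := by
    rw [← integral_add_right_eq_self (fun x => a x * (b (x - h) - b x)) h]
    simp only [add_sub_cancel_right]
  calc ∫ x, (a x - a (x + h)) * (b x - b (x + h))
      = (∫ x, a x * (b x - b (x + h))) - ∫ x, a (x + h) * (b x - b (x + h)) := by
        rw [← integral_sub (integrable_mul_of_memLp ha hd) (integrable_mul_of_memLp ha1 hd)]
        simp only [sub_mul]
    _ = ∫ x, a x * secondDiff b x h := by
        rw [hshift, ← integral_sub (integrable_mul_of_memLp ha hd) (integrable_mul_of_memLp ha hd2)]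
        congr 1
        ext x
        rw [secondDiff]
        ring

theorem inner_testDiff (φ ψ : Test) :
    inner ℝ (testDiff φ) (testDiff ψ) = ∫ x, halfLaplacian φ x * ψ x := by
  have h1 : inner ℝ (testDiff φ) (testDiff ψ) = ∫ z, diff φ z * diff ψ z ∂gagMeas := by
    rw [L2.inner_def]
    refine integral_congr_ae ?_
    filter_upwards [φ.memLp_diff.coeFn_toLp, ψ.memLp_diff.coeFn_toLp] with z hz hz'
    change inner ℝ ((φ.memLp_diff.toLp) z) ((ψ.memLp_diff.toLp) z) = _
    rw [hz, hz']
    simp [mul_comm]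
  have hint : Integrable (fun z => diff φ z * diff ψ z) gagMeas :=
    MemLp.integrable_mul φ.memLp_diff ψ.memLp_diff
  have h2 : ∫ z, diff φ z * diff ψ z ∂gagMeas =
      ∫ h, ∫ x, diff φ (x, x + h) * diff ψ (x, x + h) ∂volume ∂incMeas := by
    rw [← measurePreserving_shear.map_eq] at hint ⊢
    rw [integral_map measurePreserving_shear.measurable.aemeasurable hint.1, integral_prod]
    exact hint.comp_measurable measurePreserving_shear.measurable
  rw [h1, h2]
  simp only [mul_comm (halfLaplacian φ _)]
  rw [integral_mul_halfLaplacian (ψ.memLp 3) (by norm_num) (by simp)]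
  refine integral_congr_ae (Eventually.of_forall fun h => ?_)
  simp only
  rw [← integral_diff_mul_diff (p := 3) (q := 3 / 2) (ψ.memLp 3) (φ.memLp _)]
  congr 1
  ext x
  simp only [diff]
  ring

/-- This makes `(-Δ)^{1/2} φ` an admissible variation whose pairings are explicit: its
representative is the difference function of `φ`. -/
theorem hasRep_halfLaplacian (φ : Test) : HasRep (halfLaplacian φ) (testDiff φ) where
  locallyIntegrable := (φ.memLp_halfLaplacian le_rfl (by simp)).locallyIntegrable le_rfl
  mem := testDiff_mem φ
  integral_eq ψ := (inner_testDiff φ ψ).symm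

theorem MemHHalf.inner_testDiff {u : Plane → ℝ} (hu : MemHHalf u) (φ : Test) :
    inner ℝ (testDiff φ) hu.hasDiff.memLp.toLp = ∫ x, halfLaplacian φ x * u x := by
  have hd := hu.hasDiff.memLp
  obtain ⟨hu4, ψ, hψ, hψ4⟩ := hu
  refine tendsto_nhds_unique ((hasRep_halfLaplacian φ).tendsto_integral hd hψ) ?_
  have h43 : (1 : ℝ≥0∞) ≤ 4 / 3 := by
    rw [ENNReal.le_div_iff_mul_le (by simp) (by simp)]
    norm_num
  have hm := φ.memLp_halfLaplacian h43 (ENNReal.div_ne_top (by simp) (by simp))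
  refine tendsto_integral_mul (p := 4 / 3) (q := 4) (fun _ => hm) (fun n => (ψ n).memLp 4) hm hu4
    (by simp) ?_
  refine hψ4.congr fun n => ?_
  rw [eLpNorm_sub_swap]

/-- The distributional form of the Euler–Lagrange equation. -/
theorem IsMinimizer.integral_halfLaplacian {V ρ : Plane → ℝ} (hV : MemDual V)
    (h : IsMinimizer V ρ) (φ : Test) :
    (∫ x, signedSqrt (ρ x) * halfLaplacian φ x) + ∫ x, ρ x * φ x =
      ∫ x, V x * halfLaplacian φ x := by
  obtain ⟨V₁, V₂, hd⟩ := hV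
  obtain ⟨f, hf⟩ := h.1.exists_rep
  have hL := φ.memLp_halfLaplacian one_le_three_halves three_halves_ne_top
  -- With this variation the Hilbert term `inner ℝ f (testDiff φ)` is `∫ ρ φ`, since `f` represents
  -- `ρ`.
  have hEL := h.variation_eq_zero hd hf (hasRep_halfLaplacian φ) hL
  rw [hd.1.inner_testDiff, ← hf.integral_eq] at hEL
  have h43 : (1 : ℝ≥0∞) ≤ 4 / 3 := by
    rw [ENNReal.le_div_iff_mul_le (by simp) (by simp)]
    norm_num
  have hm := φ.memLp_halfLaplacian h43 (ENNReal.div_ne_top (by simp) (by simp))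
  have hsum : ∫ x, V x * halfLaplacian φ x =
      (∫ x, halfLaplacian φ x * V₁ x) + ∫ x, halfLaplacian φ x * V₂ x := by
    rw [← integral_add (integrable_mul_of_memLp hm hd.1.1) (integrable_mul_of_memLp hL hd.2.1)]
    refine integral_congr_ae ?_
    filter_upwards [hd.2.2] with x hx
    rw [hx]
    ring
  rw [hsum]
  linarith

/-! ### Mollification is self-adjoint -/

section Adjoint

variable {p q : ℝ≥0∞} [ENNReal.HolderTriple p q 1]

theorem integral_mul_moll (n : ℕ) {u b : Plane → ℝ} (hu : MemLp u p) (hb : MemLp b q) :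
    ∫ x, u x * moll n b x = ∫ t, kern n t * ∫ x, u x * b (x - t) := by
  have hsub : ∀ t, MemLp (fun x => b (x - t)) q := fun t =>
    hb.comp_measurePreserving (measurePreserving_sub_right volume t)
  have hm : AEStronglyMeasurable (fun z : Plane × Plane => u z.1 * (kern n z.2 * b (z.1 - z.2)))
      (volume.prod volume) := by
    refine (hu.1.comp_quasiMeasurePreserving Measure.quasiMeasurePreserving_fst).mul
      (((continuous_kern n).comp continuous_snd).aestronglyMeasurable.mul ?_)
    exact hb.1.comp_quasiMeasurePreserving
      (quasiMeasurePreserving_sub_of_right_invariant volume volume)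
  have hint : Integrable (fun z : Plane × Plane => u z.1 * (kern n z.2 * b (z.1 - z.2)))
      (volume.prod volume) := by
    rw [integrable_prod_iff' hm]
    refine ⟨Eventually.of_forall fun t => ?_, ?_⟩
    · refine ((integrable_mul_of_memLp hu (hsub t)).const_mul (kern n t)).congr
        (Eventually.of_forall fun x => ?_)
      simp only
      ring
    · refine Integrable.mono' ((integrable_kern n).mul_const
        ((eLpNorm u p volume).toReal * (eLpNorm b q volume).toReal))
        hm.norm.prod_swap.integral_prod_right' (Eventually.of_forall fun t => ?_)
      have h1 := abs_integral_mul_le hu.norm (hsub t).norm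
      have heq : eLpNorm (fun x => b (x - t)) q volume = eLpNorm b q volume :=
        eLpNorm_comp_measurePreserving hb.1 (measurePreserving_sub_right volume t)
      rw [eLpNorm_norm, eLpNorm_norm, heq] at h1
      have h2 : ∫ x, ‖u x * (kern n t * b (x - t))‖ = kern n t * ∫ x, ‖u x‖ * ‖b (x - t)‖ := by
        rw [← integral_const_mul]
        congr 1
        ext x
        rw [norm_mul, norm_mul, Real.norm_of_nonneg (kern_nonneg n t)]
        ring
      change ‖∫ x, ‖u x * (kern n t * b (x - t))‖‖ ≤ _
      rw [h2, norm_mul, Real.norm_of_nonneg (kern_nonneg n t)]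
      exact mul_le_mul_of_nonneg_left h1 (kern_nonneg n t)
  calc ∫ x, u x * moll n b x = ∫ x, ∫ t, u x * (kern n t * b (x - t)) := by
        simp only [moll_apply, integral_const_mul]
    _ = ∫ t, ∫ x, u x * (kern n t * b (x - t)) := integral_integral_swap hint
    _ = _ := by
        congr 1
        ext t
        rw [← integral_const_mul]
        congr 1
        ext x
        ring

/-- The kernel is even: reflecting `t` and translating `x` by `t` moves the shift from one factor to
the other. -/
theorem integral_mul_moll_comm (n : ℕ) {u b : Plane → ℝ} (hu : MemLp u p) (hb : MemLp b q) :
    ∫ x, u x * moll n b x = ∫ x, moll n u x * b x := by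
  have : ENNReal.HolderTriple q p 1 := ENNReal.HolderTriple.symm
  simp only [mul_comm (moll n u _)]
  rw [integral_mul_moll n hu hb, integral_mul_moll n hb hu,
    ← integral_neg_eq_self (fun t => kern n t * ∫ x, u x * b (x - t))]
  congr 1
  ext t
  rw [kern_neg, ← integral_sub_right_eq_self (fun x => u x * b (x - -t)) t]
  simp only [sub_neg_eq_add, sub_add_cancel, mul_comm]

end Adjoint

theorem moll_secondDiff (n : ℕ) {b : Plane → ℝ} (hb : LocallyIntegrable b)
    (hs : ∀ h, LocallyIntegrable fun x => b (x + h)) (h x : Plane) :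
    moll n (fun x => secondDiff b x h) x = secondDiff (moll n b) x h := by
  have h1 : (fun x => secondDiff b x h) =
      ((b - fun x => b (x + h)) + b) - fun x => b (x - h) := by
    ext x
    simp only [secondDiff, Pi.sub_apply, Pi.add_apply]
    ring
  have h2 : moll n (fun y => b (y + h)) x = moll n b (x + h) := moll_comp_add_right n b h x
  have h3 : moll n (fun y => b (y - h)) x = moll n b (x - h) := by
    simpa only [← sub_eq_add_neg] using moll_comp_add_right n b (-h) x
  have hs' : LocallyIntegrable fun x => b (x - h) := by
    simpa only [← sub_eq_add_neg] using hs (-h)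
  rw [h1, moll_sub n ((hb.sub (hs h)).add hb) hs', moll_add n (hb.sub (hs h)) hb,
    moll_sub n hb (hs h)]
  simp only [Pi.sub_apply, Pi.add_apply, h2, h3, secondDiff]
  ring

/-! ### Truncated mollifications have compact support -/

theorem abs_moll_le (n : ℕ) {v : Plane → ℝ} (hv : MemLp v 3) (x : Plane) :
    |moll n v x| ≤ (eLpNorm (kern n) (3 / 2) volume).toReal * (eLpNorm v 3 volume).toReal := by
  have hk : MemLp (kern n) (3 / 2) :=
    (continuous_kern n).memLp_of_hasCompactSupport (hasCompactSupport_kern n)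
  have hv' : MemLp (fun t => v (x - t)) 3 :=
    hv.comp_measurePreserving (Measure.measurePreserving_sub_left volume x)
  have h1 := abs_integral_mul_le hk hv'
  have heq : eLpNorm (fun t => v (x - t)) 3 volume = eLpNorm v 3 volume :=
    eLpNorm_comp_measurePreserving hv.1 (Measure.measurePreserving_sub_left volume x)
  rwa [heq, ← moll_apply] at h1

/-- For `g` compactly supported and close to `u` in `L³`, `moll n u` is uniformly within `δ` of
`moll n g`. Where the latter vanishes, `moll n u ≥ -δ`. -/
theorem hasCompactSupport_truncated_moll (n : ℕ) {u : Plane → ℝ} (hu : MemLp u 3) {δ : ℝ}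
    (hδ : 0 < δ) : HasCompactSupport fun x => max (-δ - moll n u x) 0 := by
  set K := (eLpNorm (kern n) (3 / 2) volume).toReal
  have hK : 0 ≤ K := ENNReal.toReal_nonneg
  -- Taking `K + 1` avoids division by zero.
  have hε : 0 < δ / (K + 1) := by positivity
  obtain ⟨g, hgc, hgu, hg, hgp⟩ := hu.exists_hasCompactSupport_eLpNorm_sub_le (by simp)
    (ENNReal.ofReal_pos.2 hε).ne'
  refine (hasCompactSupport_moll n hgc).mono fun x hx hx0 => hx ?_
  refine max_eq_right ?_
  have h1 := abs_moll_le n (hu.sub hgp) x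
  rw [moll_sub n (hu.locallyIntegrable (by norm_num)) (hgp.locallyIntegrable (by norm_num)),
    Pi.sub_apply, hx0, sub_zero] at h1
  have h2 : (eLpNorm (u - g) 3 volume).toReal ≤ δ / (K + 1) :=
    ENNReal.toReal_le_of_le_ofReal hε.le hgu
  have h3 : K * (δ / (K + 1)) ≤ δ := by
    rw [← mul_div_assoc, div_le_iff₀ (by positivity)]
    nlinarith
  have h4 := h1.trans (mul_le_mul_of_nonneg_left h2 hK)
  linarith [(abs_le.1 (h4.trans h3)).1]

/-! ### Positivity of the minimizer -/

/-- The outer mollification in `Φ` is moved onto `u`, so the form pairs the increments of `moll n u`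
with those of a nonincreasing function of `moll n u`; their product is nonpositive. -/
theorem integral_mul_halfLaplacian_moll_nonpos (n : ℕ) {u : Plane → ℝ} (hu : MemLp u 3) {δ : ℝ}
    {Φ : Test} (hb : Continuous fun x => max (-δ - moll n u x) 0)
    (hc : HasCompactSupport fun x => max (-δ - moll n u x) 0)
    (hΦ : (Φ : Plane → ℝ) = moll n fun x => max (-δ - moll n u x) 0) :
    ∫ x, u x * halfLaplacian Φ x ≤ 0 := by
  set b : Plane → ℝ := fun x => max (-δ - moll n u x) 0
  have hbp : MemLp b (3 / 2) := hb.memLp_of_hasCompactSupport hc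
  have hsh : ∀ h, MemLp (fun x => b (x + h)) (3 / 2) := fun h =>
    hbp.comp_measurePreserving (measurePreserving_add_right volume h)
  have hsh' : ∀ h, MemLp (fun x => b (x - h)) (3 / 2) := fun h =>
    hbp.comp_measurePreserving (measurePreserving_sub_right volume h)
  rw [integral_mul_halfLaplacian hu (by norm_num) (by simp)]
  refine integral_nonpos fun h => ?_
  have hsd : MemLp (fun x => secondDiff b x h) (3 / 2) :=
    ((hbp.const_mul 2).sub (hsh h)).sub (hsh' h)
  have : ENNReal.HolderTriple 3 (3 / 2) 1 := ENNReal.HolderTriple.symm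
  have h1 : ∫ x, u x * secondDiff Φ x h = ∫ x, moll n u x * secondDiff b x h := by
    rw [← integral_mul_moll_comm (p := 3) (q := 3 / 2) n hu hsd]
    congr 1
    ext x
    rw [moll_secondDiff n (hbp.locallyIntegrable one_le_three_halves)
      (fun h => (hsh h).locallyIntegrable one_le_three_halves), hΦ]
  simp only [Pi.zero_apply]
  rw [h1, ← integral_diff_mul_diff (p := 3) (q := 3 / 2) (memLp_moll n hu (by norm_num) (by simp))
    hbp]
  refine integral_nonpos fun x => ?_
  simp only [Pi.zero_apply, b]
  rcases le_total (moll n u x) (moll n u (x + h)) with hle | hle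
  · exact mul_nonpos_of_nonpos_of_nonneg (by linarith)
      (sub_nonneg.2 (max_le_max (by linarith) le_rfl))
  · exact mul_nonpos_of_nonneg_of_nonpos (by linarith)
      (sub_nonpos.2 (max_le_max (by linarith) le_rfl))

/-- Contractivity of mollification and the Lipschitz bound for truncation reduce this to the
convergence of the mollifications of `u` and of its truncation. -/
theorem tendsto_eLpNorm_moll_truncated {u : Plane → ℝ} (hu : MemLp u 3) {δ : ℝ}
    (hw : MemLp (fun x => max (-δ - u x) 0) 3)
    (hb : ∀ n, MemLp (fun x => max (-δ - moll n u x) 0) 3) :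
    Tendsto (fun n => eLpNorm ((moll n fun x => max (-δ - moll n u x) 0) -
      fun x => max (-δ - u x) 0) 3 volume) atTop (𝓝 0) := by
  set w : Plane → ℝ := fun x => max (-δ - u x) 0
  set b : ℕ → Plane → ℝ := fun n x => max (-δ - moll n u x) 0
  have hlim := (tendsto_eLpNorm_moll_sub hu (by norm_num) (by simp)).add
    (tendsto_eLpNorm_moll_sub hw (by norm_num) (by simp))
  rw [add_zero] at hlim
  refine tendsto_of_tendsto_of_tendsto_of_le_of_le tendsto_const_nhds hlim (fun n => zero_le)
    (fun n => ?_)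
  simp only
  have hdec : moll n (b n) - w = moll n (b n - w) + (moll n w - w) := by
    rw [moll_sub n ((hb n).locallyIntegrable (by norm_num)) (hw.locallyIntegrable (by norm_num))]
    abel
  have h1 := eLpNorm_add_le (memLp_moll n ((hb n).sub hw) (by norm_num) (by simp)).1
    ((memLp_moll n hw (by norm_num) (by simp)).1.sub hw.1) (p := 3) (by norm_num)
  rw [← hdec] at h1
  refine h1.trans ?_
  gcongr
  refine (eLpNorm_moll_le n ((hb n).sub hw).1 (by norm_num) (by simp)).trans ?_
  refine eLpNorm_mono fun x => ?_
  simp only [Pi.sub_apply, Real.norm_eq_abs, w]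
  refine (abs_max_sub_max_le_abs _ _ _).trans (le_of_eq ?_)
  rw [sub_sub_sub_cancel_left, abs_sub_comm]

theorem IsMinimizer.nonneg {V ρ : Plane → ℝ} (hV : MemDual V) (h : IsMinimizer V ρ)
    (hpos : HalfLaplacianNonneg V) : ∀ᵐ x, 0 ≤ ρ x := by
  have hρ := h.1.2
  set u : Plane → ℝ := fun x => signedSqrt (ρ x)
  have hu : MemLp u 3 := memLp_signedSqrt hρ
  have key : ∀ δ : ℝ, 0 < δ → ∀ᵐ x, -δ ≤ u x := by
    intro δ hδ
    have hcont : ∀ n, Continuous fun x => max (-δ - moll n u x) 0 := fun n =>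
      (continuous_const.sub (continuous_moll n (hu.locallyIntegrable (by norm_num)))).max
        continuous_const
    have hsupp := fun n => hasCompactSupport_truncated_moll n hu hδ
    have hb : ∀ n (p : ℝ≥0∞), MemLp (fun x => max (-δ - moll n u x) 0) p := fun n p =>
      (hcont n).memLp_of_hasCompactSupport (hsupp n)
    have hw : MemLp (fun x => max (-δ - u x) 0) 3 := by
      refine hu.mono ?_ (Eventually.of_forall fun x => ?_)
      · exact ((continuous_const.sub continuous_id).max
          continuous_const : Continuous fun y : ℝ => max (-δ - y) 0).comp_aestronglyMeasurable hu.1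
      · rw [Real.norm_eq_abs, Real.norm_eq_abs, abs_of_nonneg (le_max_right _ _)]
        exact max_le (by linarith [neg_abs_le (u x)]) (abs_nonneg _)
    -- In the distributional equation the side with `V` is nonnegative by hypothesis and the term
    -- with `u` is nonpositive, so the term with `ρ` is nonnegative.
    have hn : ∀ n, 0 ≤ ∫ x, ρ x * (moll n fun x => max (-δ - moll n u x) 0) x := by
      intro n
      set Φ : Test := mollTest n _ ((hb n 3).locallyIntegrable (by norm_num)) (hsupp n)
      have hΦ0 : ∀ x, 0 ≤ Φ x := fun x =>
        integral_nonneg fun t => mul_nonneg (kern_nonneg n t) (le_max_right _ _)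
      have h1 := h.integral_halfLaplacian hV Φ
      have h2 := hpos Φ hΦ0
      have h3 := integral_mul_halfLaplacian_moll_nonpos n hu (hcont n) (hsupp n) (Φ := Φ) rfl
      have h4 : 0 ≤ ∫ x, ρ x * Φ x := by linarith
      exact h4
    have hlim := tendsto_integral_mul (p := 3 / 2) (q := 3) (fun _ : ℕ => hρ)
      (fun n => memLp_moll n (hb n 3) (by norm_num) (by simp)) hρ hw (by simp)
      (tendsto_eLpNorm_moll_truncated hu hw fun n => hb n 3)
    have hint := ge_of_tendsto' hlim hn
    -- The truncation is nonzero only where `u < -δ`, and `ρ` has the sign of `u`. The limiting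
    -- integral is thus both nonnegative and nonpositive, so its integrand vanishes almost
    -- everywhere.
    have hsign : ∀ x, ρ x * max (-δ - u x) 0 ≤ 0 := fun x => by
      rcases le_total (-δ - u x) 0 with hx | hx
      · rw [max_eq_right hx, mul_zero]
      · refine mul_nonpos_of_nonpos_of_nonneg ?_ (le_max_right _ _)
        rw [← signedSqrt_mul_abs (ρ x)]
        exact mul_nonpos_of_nonpos_of_nonneg (by linarith) (abs_nonneg _)
    have hneg : ∫ x, -(ρ x * max (-δ - u x) 0) = 0 := by
      refine le_antisymm ?_ (integral_nonneg fun x => neg_nonneg.2 (hsign x))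
      rw [integral_neg]
      linarith
    have hae := (integral_eq_zero_iff_of_nonneg (fun x => neg_nonneg.2 (hsign x))
      (integrable_mul_of_memLp hρ hw).neg).1 hneg
    filter_upwards [hae] with x hx
    by_contra! hlt
    have h1 : max (-δ - u x) 0 = -δ - u x := max_eq_left (by linarith)
    have h2 : ρ x < 0 := by
      rw [← signedSqrt_mul_abs (ρ x)]
      refine mul_neg_of_neg_of_pos (by linarith) (abs_pos.2 ?_)
      have : u x < 0 := by linarith
      exact this.ne
    simp only [Pi.zero_apply, neg_eq_zero, h1, mul_eq_zero] at hx
    rcases hx with hx | hx <;> linarith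
  have hall : ∀ᵐ x, ∀ n : ℕ, -(1 / ((n : ℝ) + 1)) ≤ u x :=
    ae_all_iff.2 fun n => key _ (by positivity)
  filter_upwards [hall] with x hx
  have hux : 0 ≤ u x := by
    have := tendsto_one_div_add_atTop_nhds_zero_nat (𝕜 := ℝ) |>.neg
    rw [neg_zero] at this
    exact le_of_tendsto' this hx
  rw [← signedSqrt_mul_abs (ρ x)]
  exact mul_nonneg hux (abs_nonneg _)

end GrapheneTF

end

theorem theorem2p1 (V : GrapheneTF.Plane → ℝ) (hV : GrapheneTF.MemDual V) :
    -- the pairing with `V` does not depend on the decomposition of `V`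
    (∀ ρ V₁ V₂ : GrapheneTF.Plane → ℝ, GrapheneTF.MemH0 ρ →
      GrapheneTF.IsDecomposition V V₁ V₂ →
        GrapheneTF.dualPairing ρ V = GrapheneTF.hPair ρ V₁ + ∫ x, ρ x * V₂ x) ∧
    ∃ ρV : GrapheneTF.Plane → ℝ,
      GrapheneTF.IsMinimizer V ρV ∧
      (∀ ρ : GrapheneTF.Plane → ℝ, GrapheneTF.IsMinimizer V ρ → ρ =ᵐ[volume] ρV) ∧
      GrapheneTF.EulerLagrange V ρV ∧
      (GrapheneTF.HalfLaplacianNonneg V → ∀ᵐ x, 0 ≤ ρV x) := by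
  refine ⟨fun ρ V₁ V₂ hρ hd => ?_, ?_⟩
  · obtain ⟨f, hf⟩ := hρ.exists_rep
    rw [GrapheneTF.dualPairing_eq hf hρ.2 hd, hf.hPair_eq hd.1]
  · obtain ⟨ρV, h⟩ := GrapheneTF.exists_isMinimizer hV
    exact ⟨ρV, h, fun ρ h' => h'.ae_eq hV h, h.eulerLagrange hV, h.nonneg hV⟩
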